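/- Let $d\ge 1$ be an integer and $u\in\mathbb C\setminus\{0\}$. For $n\ge 0$ let ${\rm Y}_{d,n}(u)$ be the Yokonuma--Hecke algebra: the unital associative $\mathbb C$-algebra generated by $g_1,\dots,g_{n-1}$ and $t_1,\dots,t_n$ subject to $$g_ig_j=g_jg_i\ (|i-j|>1),\quad g_ig_jg_i=g_jg_ig_j\ (|i-j|=1),\quad t_it_j=t_jt_i,\quad t_jg_i=g_it_{s_i(j)},\quad t_i^d=1,$$ $$g_i^2=1+(u-1)e_i+(u-1)e_ig_i,\qquad e_i:=\frac1d\sum_{s=0}^{d-1}t_i^st_{i+1}^{d-s},$$ where $s_i=(i,\,i+1)$. Let $R$ be a commutative $\mathbb C$-algebra (for instance $\mathbb C$, or $\mathbb C(z,x_1,\dots,x_{d-1})$), let $z,x_1,\dots,x_{d-1}\in R$, and put $x_0:=1$, the indices of the $x_k$ being taken in $\mathbb Z/d\mathbb Z$. There is a unique $\mathbb C$-linear map ${\rm tr}$ from the inductive limit of the algebras ${\rm Y}_{d,n}(u)$ (with respect to the natural homomorphisms ${\rm Y}_{d,n}(u)\to{\rm Y}_{d,n+1}(u)$) to $R$ such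 that ${\rm tr}(1)=1$ and, for all $n$ and all $a,b\in{\rm Y}_{d,n}(u)$, $${\rm tr}(ab)={\rm tr}(ba),\qquad {\rm tr}(a\,g_n)=z\,{\rm tr}(a)\ (n\ge1),\qquad {\rm tr}(a\,t_{n+1}^m)=x_m\,{\rm tr}(a)\quad(1\le m\le d-1)$$ (the Juyumaya trace with parameters $z,x_1,\dots,x_{d-1}$). For $n\ge3$ let $${\rm CTL}_{d,n}(u):={\rm Y}_{d,n}(u)\big/\langle c_{i,i+1}\,;\,1\le i\le n-2\rangle,\qquad c_{i,i+1}:=\sum_{\alpha,\beta,\gamma\in\mathbb Z/d\mathbb Z}t_i^\alpha t_{i+1}^\beta t_{i+2}^\gamma\,(g_ig_{i+1}g_i+g_{i+1}g_i+g_ig_{i+1}+g_i+g_{i+1}+1)$$ (quotient by the two-sided ideal generated by the $c_{i,i+1}$) be the Complex Reflection Temperley--Lieb algebra. Then for every $n\ge3$ the trace ${\rm tr}$ on ${\rm Y}_{d,n}(u)$ passes to the quotient ${\rm CTL}_{d,n}(u)$ (that is, factors through the canonical projection ${\rm Y}_{d,n}(u)\to{\rm CTL}_{d,n}(u)$) if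 and only if $$(u+1)z^2\sum_{k\in\mathbb Z/d\mathbb Z}x_k+(u+2)z\sum_{k\in\mathbb Z/d\mathbb Z}E^{(k)}+\sum_{k\in\mathbb Z/d\mathbb Z}{\rm tr}(e_1^{(k)}e_2)=0,$$ where, for $0\le k\le d-1$, $e_1^{(k)}:=\frac1d\sum_{s=0}^{d-1}t_1^{k+s}t_2^{d-s}$ and $E^{(k)}:={\rm tr}(e_1^{(k)})$. -/

import Mathlib

namespace YokonumaHecke

/-- Generators of the Yokonuma–Hecke algebra on `n` strands, indexed from `0`: the braiding
generators `g i` (with `i + 1 < n`) and the framing generators `t j` (with `j < n`). -/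
inductive Gen (n : ℕ) : Type
  | g (i : ℕ) (h : i + 1 < n) : Gen n
  | t (j : Fin n) : Gen n

/-- The braiding generator `g_i` in the free algebra. -/
noncomputable abbrev freeG {n : ℕ} (i : ℕ) (h : i + 1 < n) : FreeAlgebra ℂ (Gen n) :=
  FreeAlgebra.ι ℂ (Gen.g i h)

/-- The framing generator `t_j` in the free algebra. -/
noncomputable abbrev freeT {n : ℕ} (j : Fin n) : FreeAlgebra ℂ (Gen n) :=
  FreeAlgebra.ι ℂ (Gen.t j)

/-- The elementary transposition `s_i = (i, i + 1)`. -/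
abbrev sw {n : ℕ} (i : ℕ) (h : i + 1 < n) : Equiv.Perm (Fin n) :=
  Equiv.swap ⟨i, Nat.lt_of_succ_lt h⟩ ⟨i + 1, h⟩

/-- `e_i = (1/d) ∑_{s=0}^{d-1} t_i^s t_{i+1}^{d-s}` in the free algebra. -/
noncomputable def freeE (d : ℕ) {n : ℕ} (i : ℕ) (h : i + 1 < n) : FreeAlgebra ℂ (Gen n) :=
  (1 / (d : ℂ)) • ∑ s ∈ Finset.range d,
    freeT (⟨i, Nat.lt_of_succ_lt h⟩ : Fin n) ^ s * freeT (⟨i + 1, h⟩ : Fin n) ^ (d - s)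

/-- Defining relations of the Yokonuma–Hecke algebra `Y_{d,n}(u)`. -/
inductive Rel (d n : ℕ) (u : ℂ) : FreeAlgebra ℂ (Gen n) → FreeAlgebra ℂ (Gen n) → Prop
  | g_comm (i j : ℕ) (hi : i + 1 < n) (hj : j + 1 < n) (hij : i + 1 < j) :
      Rel d n u (freeG i hi * freeG j hj) (freeG j hj * freeG i hi)
  | g_braid (i : ℕ) (hi : i + 1 < n) (hi' : i + 1 + 1 < n) :
      Rel d n u (freeG i hi * freeG (i + 1) hi' * freeG i hi)
        (freeG (i + 1) hi' * freeG i hi * freeG (i + 1) hi')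
  | t_comm (i j : Fin n) : Rel d n u (freeT i * freeT j) (freeT j * freeT i)
  | t_g (i : ℕ) (hi : i + 1 < n) (j : Fin n) :
      Rel d n u (freeT j * freeG i hi) (freeG i hi * freeT (sw i hi j))
  | t_pow (j : Fin n) : Rel d n u (freeT j ^ d) 1
  | g_sq (i : ℕ) (hi : i + 1 < n) :
      Rel d n u (freeG i hi ^ 2)
        (1 + (u - 1) • freeE d i hi + (u - 1) • (freeE d i hi * freeG i hi))

/-- The Yokonuma–Hecke algebra `Y_{d,n}(u)` over `ℂ`. -/
abbrev YH (d n : ℕ) (u : ℂ) : Type := RingQuot (Rel d n u)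

/-- The braiding generator `g_i` of `Y_{d,n}(u)`. -/
noncomputable def g (d : ℕ) {n : ℕ} (u : ℂ) (i : ℕ) (h : i + 1 < n) : YH d n u :=
  RingQuot.mkAlgHom ℂ (Rel d n u) (freeG i h)

/-- The framing generator `t_j` of `Y_{d,n}(u)`. -/
noncomputable def t (d : ℕ) {n : ℕ} (u : ℂ) (j : ℕ) (h : j < n) : YH d n u :=
  RingQuot.mkAlgHom ℂ (Rel d n u) (freeT ⟨j, h⟩)

/-- The image of a generator under the natural map `Y_{d,n}(u) → Y_{d,n+1}(u)`. -/
noncomputable def inclGen (d n : ℕ) (u : ℂ) : Gen n → YH d (n + 1) u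
  | Gen.g i h => g d u i (Nat.lt_succ_of_lt h)
  | Gen.t j => t d u j (Nat.lt_succ_of_lt j.isLt)

theorem inclGen_rel (d n : ℕ) (u : ℂ) ⦃a b : FreeAlgebra ℂ (Gen n)⦄ (hab : Rel d n u a b) :
    FreeAlgebra.lift ℂ (inclGen d n u) a = FreeAlgebra.lift ℂ (inclGen d n u) b := by
  have key : ∀ {a b : FreeAlgebra ℂ (Gen (n + 1))}, Rel d (n + 1) u a b →
      RingQuot.mkAlgHom ℂ (Rel d (n + 1) u) a = RingQuot.mkAlgHom ℂ (Rel d (n + 1) u) b :=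
    fun h => RingQuot.mkAlgHom_rel ℂ h
  cases hab with
  | g_comm i j hi hj hij =>
    simpa [inclGen, g, t] using
      key (Rel.g_comm i j (Nat.lt_succ_of_lt hi) (Nat.lt_succ_of_lt hj) hij)
  | g_braid i hi hi' =>
    simpa [inclGen, g, t] using
      key (Rel.g_braid i (Nat.lt_succ_of_lt hi) (Nat.lt_succ_of_lt hi'))
  | t_comm i j =>
    simpa [inclGen, g, t] using key (Rel.t_comm ⟨i, Nat.lt_succ_of_lt i.isLt⟩ ⟨j, Nat.lt_succ_of_lt j.isLt⟩)
  | t_g i hi j =>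
    have h := key (Rel.t_g (d := d) (u := u) i (Nat.lt_succ_of_lt hi)
      ⟨j, Nat.lt_succ_of_lt j.isLt⟩)
    have hs : sw i (Nat.lt_succ_of_lt hi) ⟨j, Nat.lt_succ_of_lt j.isLt⟩ =
        ⟨sw i hi j, Nat.lt_succ_of_lt (sw i hi j).isLt⟩ :=
      (Fin.castSucc_injective n).swap_apply ⟨i, Nat.lt_of_succ_lt hi⟩ ⟨i + 1, hi⟩ j
    rw [hs] at h
    simpa [inclGen, g, t] using h
  | t_pow j =>
    simpa [inclGen, g, t] using key (Rel.t_pow ⟨j, Nat.lt_succ_of_lt j.isLt⟩)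
  | g_sq i hi =>
    simpa [inclGen, g, t, freeE] using key (Rel.g_sq i (Nat.lt_succ_of_lt hi))

/-- The natural algebra homomorphism `Y_{d,n}(u) → Y_{d,n+1}(u)`, `g_i ↦ g_i`, `t_j ↦ t_j`. -/
noncomputable def incl (d n : ℕ) (u : ℂ) : YH d n u →ₐ[ℂ] YH d (n + 1) u :=
  RingQuot.liftAlgHom ℂ ⟨FreeAlgebra.lift ℂ (inclGen d n u), inclGen_rel d n u⟩

/-- `e_i^{(k)} = (1/d) ∑_{s=0}^{d-1} t_i^{k+s} t_{i+1}^{d-s}` in `Y_{d,n}(u)`. -/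
noncomputable def eK (d : ℕ) {n : ℕ} (u : ℂ) (i : ℕ) (h : i + 1 < n) (k : ℕ) : YH d n u :=
  (1 / (d : ℂ)) • ∑ s ∈ Finset.range d,
    t d u i (Nat.lt_of_succ_lt h) ^ (k + s) * t d u (i + 1) h ^ (d - s)

/-- `e_i = e_i^{(0)}` in `Y_{d,n}(u)`. -/
noncomputable abbrev e (d : ℕ) {n : ℕ} (u : ℂ) (i : ℕ) (h : i + 1 < n) : YH d n u :=
  eK d u i h 0

/-- The Steinberg-type element `g_{i,i+1}`. -/
noncomputable def gSteinberg (d : ℕ) {n : ℕ} (u : ℂ) (i : ℕ) (h : i + 2 < n) : YH d n u :=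
  let a := g d u i (Nat.lt_of_succ_lt h)
  let b := g d u (i + 1) h
  a * b * a + b * a + a * b + a + b + 1

/-- `c_{i,i+1} = ∑_{α,β,γ ∈ ℤ/dℤ} t_i^α t_{i+1}^β t_{i+2}^γ g_{i,i+1}`. -/
noncomputable def c (d : ℕ) [NeZero d] {n : ℕ} (u : ℂ) (i : ℕ) (h : i + 2 < n) : YH d n u :=
  ∑ α : ZMod d, ∑ β : ZMod d, ∑ γ : ZMod d,
    t d u i (by lia) ^ α.val * t d u (i + 1) (by lia) ^ β.val * t d u (i + 2) h ^ γ.val *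
      gSteinberg d u i h

/-- The two-sided ideal of `Y_{d,n}(u)` generated by all the elements `c_{i,i+1}`. -/
noncomputable def ctlIdeal (d : ℕ) [NeZero d] (n : ℕ) (u : ℂ) : TwoSidedIdeal (YH d n u) :=
  TwoSidedIdeal.span {y | ∃ (i : ℕ) (h : i + 2 < n), y = c d u i h}

/-- The Complex Reflection Temperley–Lieb algebra `CTL_{d,n}(u)`. -/
abbrev CTL (d : ℕ) [NeZero d] (n : ℕ) (u : ℂ) : Type := (ctlIdeal d n u).ringCon.Quotient

/-- The canonical projection `Y_{d,n}(u) → CTL_{d,n}(u)`. -/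
noncomputable def toCTL (d : ℕ) [NeZero d] (n : ℕ) (u : ℂ) : YH d n u →ₐ[ℂ] CTL d n u :=
  (ctlIdeal d n u).ringCon.mkₐ ℂ

/-- A linear map on `Y_{d,n}(u)` passes to `CTL_{d,n}(u)` if it factors through the projection. -/
def PassesToCTL (d : ℕ) [NeZero d] (n : ℕ) (u : ℂ) {R : Type*} [CommRing R] [Algebra ℂ R]
    (τ : YH d n u →ₗ[ℂ] R) : Prop :=
  ∃ τ' : CTL d n u →ₗ[ℂ] R, ∀ y, τ' (toCTL d n u y) = τ y

/-- The family `tr` is the Juyumaya trace with parameters `z` and `x_1, …, x_{d-1}`.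
A linear map on the inductive limit of the algebras `Y_{d,n}(u)` is given as a family of linear
maps compatible with the natural homomorphisms `Y_{d,n}(u) → Y_{d,n+1}(u)`. -/
structure IsJuyumayaTrace (d : ℕ) (u : ℂ) {R : Type*} [CommRing R] [Algebra ℂ R]
    (z : R) (x : ZMod d → R) (tr : ∀ n : ℕ, YH d n u →ₗ[ℂ] R) : Prop where
  map_incl : ∀ (n : ℕ) (a : YH d n u), tr (n + 1) (incl d n u a) = tr n a
  map_one : ∀ n : ℕ, tr n 1 = 1
  map_mul_comm : ∀ (n : ℕ) (a b : YH d n u), tr n (a * b) = tr n (b * a)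
  map_mul_g : ∀ (n : ℕ) (a : YH d (n + 1) u),
    tr (n + 2) (incl d (n + 1) u a * g d u n (Nat.lt_succ_self (n + 1))) = z * tr (n + 1) a
  map_mul_t : ∀ (n : ℕ) (a : YH d n u) (m : ℕ), 1 ≤ m → m ≤ d - 1 →
    tr (n + 1) (incl d n u a * t d u n (Nat.lt_succ_self n) ^ m) = x (m : ZMod d) * tr n a

end YokonumaHecke

namespace YokonumaHecke

/-! Indices are zero-based: Y_{d,n+1} has braid generators g_0, …, g_{n-1} and framings t_0, …, t_n.

Existence of the trace. Over A = Y_{d,n}[τ]/(τ^d - 1), with τ in the role of t_n, the left module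
Y_{d,n+1} should be free on the words w_k = g_{n-1} ⋯ g_k, 0 ≤ k ≤ n, with w_n = 1. No normal form
is needed: the formulas that right multiplication would have on coordinate rows are written down and
checked against the defining relations (`rowGen_rel`). Acting with y on the row of 1 yields
coordinates of y, and `extend` reads off from them the functional dictated by the Markov rules a
t_n^m ↦ x_m tr(a) and a g_{n-1} b ↦ z tr(ab). Such elements span Y_{d,n+1} (`spanTG_eq_top`), which
gives uniqueness and an induction principle. Traciality needs work only for the last braid generator
g, where it is the symmetry of (a, b) ↦ tr(a g b g); the braid relation brings this symmetry one
level down.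

The criterion. Put S_j = ∑_s t_j^s, T = S_0 S_1 S_2, X = ∑ x_k, and let c = T (sum over the six
words of S_3). The factor T absorbs framings and the idempotents e_i, so that T g² = u T + (u - 1) T
g for g = g_0, g_1, and Y_{d,3} c = ℂ c (`exists_mul_cT_eq_smul`). Hence tr(a c) is a multiple of
tr(c) for every a (`exists_map_mul_cT`). For u ≠ 0 all c_{i,i+1} are conjugate, so vanishing of tr
on the whole ideal is the single equation tr(c) = 0. The six traces add up to (u+1) d² z² X + (u+2)
d z X² + X³ (`map_cT`). As ∑ E^{(k)} = X²/d and ∑ tr(e_1^{(k)} e_2) = X³/d², this is d² times the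
expression of the theorem. -/

theorem pow_mul_eq_of_mul_eq {B : Type*} [Monoid B] {a x b : B} (h : a * x = x * b) (k : ℕ) :
    a ^ k * x = x * b ^ k :=
  SemiconjBy.pow_right (show SemiconjBy x b a from h.symm) k |>.symm

/-! ### Averaging idempotents of two commuting elements of order dividing d -/

section Idempotent

variable {B : Type*} [Ring B] [Algebra ℂ B]

/-- The averaging element `(1/d) ∑_{s<d} a^s b^{d-s}`. -/
noncomputable def avg (d : ℕ) (a b : B) : B :=
  (1 / (d : ℂ)) • ∑ s ∈ Finset.range d, a ^ s * b ^ (d - s)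

theorem avg_mul_of_mul_eq {d : ℕ} {a b a' b' x : B} (ha : a * x = x * a') (hb : b * x = x * b') :
    avg d a b * x = x * avg d a' b' := by
  simp only [avg, smul_mul_assoc, mul_smul_comm, Finset.sum_mul, Finset.mul_sum]
  congr 1
  refine Finset.sum_congr rfl fun s _ => ?_
  rw [mul_assoc, pow_mul_eq_of_mul_eq hb, ← mul_assoc, pow_mul_eq_of_mul_eq ha, mul_assoc]

/-- Since `a ^ d = b ^ d = 1`, the sum may equally run over s = 1, …, d; reversing that range
exchanges the two exponents. -/
theorem avg_symm {d : ℕ} {a b : B} (hab : Commute a b) (ha : a ^ d = 1) (hb : b ^ d = 1) :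
    avg d a b = avg d b a := by
  unfold avg
  congr 1
  have h1 : ∑ s ∈ Finset.range d, a ^ s * b ^ (d - s)
      = ∑ s ∈ Finset.range d, a ^ (s + 1) * b ^ (d - (s + 1)) := by
    have h := (Finset.sum_range_succ (fun s => a ^ s * b ^ (d - s)) d).symm.trans
      (Finset.sum_range_succ' (fun s => a ^ s * b ^ (d - s)) d)
    simpa [ha, hb] using h
  rw [h1, ← Finset.sum_range_reflect]
  refine Finset.sum_congr rfl fun s hs => ?_
  have hs := Finset.mem_range.mp hs
  rw [(hab.pow_pow _ _).eq]
  congr 2 <;> omega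

/-- Both products are sums of monomials of total degree d + 1, and they differ only in the end terms
a^d b and b^{d+1}, each equal to b. Thus `avg d a b` acts as the projection onto the part where a
and b coincide. -/
theorem mul_avg {d : ℕ} {a b : B} (hab : Commute a b) (ha : a ^ d = 1) (hb : b ^ d = 1) :
    a * avg d a b = b * avg d a b := by
  simp only [avg, mul_smul_comm, Finset.mul_sum]
  congr 1
  have h := (Finset.sum_range_succ (fun s => a ^ s * b ^ (d + 1 - s)) d).symm.trans
      (Finset.sum_range_succ' (fun s => a ^ s * b ^ (d + 1 - s)) d)
  have h2 : ∑ s ∈ Finset.range d, b * (a ^ s * b ^ (d - s))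
      = ∑ s ∈ Finset.range d, a ^ s * b ^ (d + 1 - s) := by
    refine Finset.sum_congr rfl fun s hs => ?_
    have hs := Finset.mem_range.mp hs
    rw [← mul_assoc, ← (hab.pow_left s).eq, mul_assoc, ← pow_succ']
    congr 2; omega
  rw [h2]
  simp only [ha, pow_succ b d, hb, Nat.add_sub_cancel_left, pow_zero, Nat.sub_zero, one_mul,
    pow_one, add_left_inj] at h
  rw [h]
  refine Finset.sum_congr rfl fun s _ => ?_
  rw [← mul_assoc, ← pow_succ', Nat.add_sub_add_right]

theorem commute_avg {d : ℕ} {a b x : B} (ha : Commute a x) (hb : Commute b x) :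
    Commute (avg d a b) x :=
  avg_mul_of_mul_eq ha hb

theorem avg_mul {d : ℕ} {a b : B} (hab : Commute a b) (ha : a ^ d = 1) (hb : b ^ d = 1) :
    avg d a b * a = avg d a b * b := by
  rw [(commute_avg (Commute.refl a) hab.symm).eq, mul_avg hab ha hb,
    (commute_avg hab (Commute.refl b)).eq]

theorem avg_mul_pow {d : ℕ} {a b : B} (hab : Commute a b) (ha : a ^ d = 1) (hb : b ^ d = 1)
    (k : ℕ) : avg d a b * a ^ k = avg d a b * b ^ k := by
  induction k with
  | zero => simp
  | succ k ih =>
    rw [pow_succ, ← mul_assoc, ih, mul_assoc, ← (hab.pow_right k).eq, ← mul_assoc,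
      avg_mul hab ha hb, mul_assoc, ← pow_succ']

/-- Next to `avg d a b` the letters a and b are interchangeable. -/
theorem avg_mul_avg_swap {d : ℕ} {a b c : B} (hab : Commute a b) (ha : a ^ d = 1)
    (hb : b ^ d = 1) : avg d a b * avg d b c = avg d a b * avg d a c := by
  conv_lhs => rw [avg.eq_1 d b c]
  conv_rhs => rw [avg.eq_1 d a c]
  simp only [mul_smul_comm, Finset.mul_sum, ← mul_assoc, avg_mul_pow hab ha hb]

theorem avg_mul_avg_self {d : ℕ} [NeZero d] {a b : B} (hab : Commute a b) (ha : a ^ d = 1)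
    (hb : b ^ d = 1) : avg d a b * avg d a b = avg d a b := by
  have : ∀ s ∈ Finset.range d, avg d a b * (a ^ s * b ^ (d - s)) = avg d a b := fun s hs => by
    have hs := Finset.mem_range.mp hs
    rw [← mul_assoc, avg_mul_pow hab ha hb, mul_assoc, ← pow_add,
      Nat.add_sub_cancel' hs.le, hb, mul_one]
  conv_lhs => arg 2; rw [avg.eq_1 d a b]
  rw [mul_smul_comm, Finset.mul_sum, Finset.sum_congr rfl this]
  have hd : (d : ℂ) ≠ 0 := Nat.cast_ne_zero.mpr (NeZero.ne d)
  rw [Finset.sum_const, Finset.card_range, ← Nat.cast_smul_eq_nsmul ℂ, smul_smul,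
    one_div_mul_cancel hd, one_smul]

theorem map_avg {C F : Type*} [Ring C] [Algebra ℂ C] [FunLike F B C] [AlgHomClass F ℂ B C]
    (φ : F) (d : ℕ) (a b : B) : φ (avg d a b) = avg d (φ a) (φ b) := by
  simp [avg, map_smul]

theorem map_mul_avg {V : Type*} [Ring V] [Algebra ℂ V] (φ : B →ₗ[ℂ] V) {d : ℕ} {a b : B}
    {a' b' : V} (ha : ∀ y, φ (y * a) = φ y * a') (hb : ∀ y, φ (y * b) = φ y * b') (y : B) :
    φ (y * avg d a b) = φ y * avg d a' b' := by
  have hpow : ∀ {c : B} {c' : V}, (∀ y, φ (y * c) = φ y * c') → ∀ (k : ℕ) (y : B),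
      φ (y * c ^ k) = φ y * c' ^ k := by
    intro c c' hc k
    induction k with
    | zero => simp
    | succ k ih => intro y; rw [pow_succ, ← mul_assoc, hc, ih, mul_assoc, ← pow_succ]
  simp only [avg, mul_smul_comm, map_smul, Finset.mul_sum, map_sum, ← mul_assoc, hpow ha, hpow hb]

end Idempotent

/-! ### Generators with total indices, their relations, and induction on words -/

variable (d n : ℕ) (u : ℂ)

/-- The braiding generator `g_i` of `Y_{d,n}(u)`, extended by `1` outside its range. -/
noncomputable def gT (i : ℕ) : YH d n u := if h : i + 1 < n then g d u i h else 1

/-- The framing generator `t_j` of `Y_{d,n}(u)`, extended by `1` outside its range. -/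
noncomputable def tT (j : ℕ) : YH d n u := if h : j < n then t d u j h else 1

variable {d n u}

theorem gT_eq {i : ℕ} (h : i + 1 < n) : gT d n u i = g d u i h := dif_pos h

theorem tT_eq {j : ℕ} (h : j < n) : tT d n u j = t d u j h := dif_pos h

theorem mk_rel {a b : FreeAlgebra ℂ (Gen n)} (h : Rel d n u a b) :
    RingQuot.mkAlgHom ℂ (Rel d n u) a = RingQuot.mkAlgHom ℂ (Rel d n u) b :=
  RingQuot.mkAlgHom_rel ℂ h

theorem gT_comm {i j : ℕ} (hij : i + 1 < j) : Commute (gT d n u i) (gT d n u j) := by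
  by_cases hj : j + 1 < n
  · rw [gT_eq hj, gT_eq (by omega : i + 1 < n)]
    have := mk_rel (Rel.g_comm (d := d) (u := u) i j (by omega) hj hij)
    simp only [map_mul] at this
    exact this
  · rw [show gT d n u j = 1 from dif_neg hj]
    exact Commute.one_right _

theorem gT_braid {i : ℕ} (h : i + 2 < n) :
    gT d n u i * gT d n u (i + 1) * gT d n u i
      = gT d n u (i + 1) * gT d n u i * gT d n u (i + 1) := by
  rw [gT_eq (by omega : i + 1 < n), gT_eq (by omega : i + 1 + 1 < n)]
  have := mk_rel (Rel.g_braid (d := d) (u := u) i (by omega) h)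
  simp only [map_mul] at this
  exact this

theorem tT_comm (i j : ℕ) : Commute (tT d n u i) (tT d n u j) := by
  by_cases hi : i < n
  · by_cases hj : j < n
    · rw [tT_eq hi, tT_eq hj]
      have := mk_rel (Rel.t_comm (d := d) (u := u) ⟨i, hi⟩ ⟨j, hj⟩)
      simp only [map_mul] at this
      exact this
    · rw [show tT d n u j = 1 from dif_neg hj]
      exact Commute.one_right _
  · rw [show tT d n u i = 1 from dif_neg hi]
    exact Commute.one_left _

theorem tT_pow (j : ℕ) : tT d n u j ^ d = 1 := by
  by_cases hj : j < n
  · rw [tT_eq hj]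
    have := mk_rel (Rel.t_pow (d := d) (u := u) ⟨j, hj⟩)
    simp only [map_pow, map_one] at this
    exact this
  · rw [show tT d n u j = 1 from dif_neg hj, one_pow]

theorem tT_mul_gT_left {i : ℕ} (h : i + 1 < n) :
    tT d n u i * gT d n u i = gT d n u i * tT d n u (i + 1) := by
  rw [gT_eq h, tT_eq h, tT_eq (by omega : i < n)]
  have := mk_rel (Rel.t_g (d := d) (u := u) i h ⟨i, by omega⟩)
  simp only [map_mul, sw, Equiv.swap_apply_left] at this
  exact this

theorem tT_mul_gT_right {i : ℕ} (h : i + 1 < n) :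
    tT d n u (i + 1) * gT d n u i = gT d n u i * tT d n u i := by
  rw [gT_eq h, tT_eq h, tT_eq (by omega : i < n)]
  have := mk_rel (Rel.t_g (d := d) (u := u) i h ⟨i + 1, h⟩)
  simp only [map_mul, sw, Equiv.swap_apply_right] at this
  exact this

theorem tT_gT_comm {i j : ℕ} (h0 : j ≠ i) (h1 : j ≠ i + 1) :
    Commute (tT d n u j) (gT d n u i) := by
  by_cases hi : i + 1 < n
  · by_cases hj : j < n
    · rw [tT_eq hj, gT_eq hi]
      have := mk_rel (Rel.t_g (d := d) (u := u) i hi ⟨j, hj⟩)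
      rw [sw, Equiv.swap_apply_of_ne_of_ne (by simpa [Fin.ext_iff]) (by simpa [Fin.ext_iff])] at this
      simp only [map_mul] at this
      exact this
    · rw [show tT d n u j = 1 from dif_neg hj]
      exact Commute.one_left _
  · rw [show gT d n u i = 1 from dif_neg hi]
    exact Commute.one_right _

variable (d n u) in
/-- The element `e_i` of `Y_{d,n}(u)`, for all `i`. -/
noncomputable def eT (i : ℕ) : YH d n u := avg d (tT d n u i) (tT d n u (i + 1))

theorem gT_sq {i : ℕ} (h : i + 1 < n) :
    gT d n u i * gT d n u i
      = 1 + (u - 1) • eT d n u i + (u - 1) • (eT d n u i * gT d n u i) := by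
  rw [eT, gT_eq h, tT_eq h, tT_eq (by omega : i < n)]
  have := mk_rel (Rel.g_sq (d := d) (u := u) i h)
  simp only [map_mul, map_add, map_smul, map_pow, map_one, freeE, map_sum, sq] at this
  exact this

theorem incl_gT {i : ℕ} (h : i + 1 < n) : incl d n u (gT d n u i) = gT d (n + 1) u i := by
  rw [gT_eq h, gT_eq (by omega)]
  simp [incl, g, inclGen]

theorem incl_tT {j : ℕ} (h : j < n) : incl d n u (tT d n u j) = tT d (n + 1) u j := by
  rw [tT_eq h, tT_eq (by omega)]
  simp [incl, t, inclGen]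

theorem YH_induction {P : YH d n u → Prop} (halg : ∀ r : ℂ, P (algebraMap ℂ _ r))
    (hg : ∀ i, i + 1 < n → P (gT d n u i)) (ht : ∀ j, j < n → P (tT d n u j))
    (hadd : ∀ a b, P a → P b → P (a + b)) (hmul : ∀ a b, P a → P b → P (a * b)) (y : YH d n u) :
    P y := by
  obtain ⟨w, rfl⟩ := RingQuot.mkAlgHom_surjective ℂ (Rel d n u) y
  induction w using FreeAlgebra.induction with
  | grade0 r => simpa using halg r
  | grade1 s =>
    cases s with
    | g i h => simpa [gT_eq h, g] using hg i h
    | t j => simpa [tT_eq j.isLt, t] using ht j j.isLt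
  | mul a b ha hb => simpa using hmul _ _ ha hb
  | add a b ha hb => simpa using hadd _ _ ha hb

theorem incl_commute_tT (a : YH d n u) : Commute (incl d n u a) (tT d (n + 1) u n) := by
  induction a using YH_induction with
  | halg r => simp only [AlgHom.commutes]; exact Algebra.commutes r _
  | hg i h => rw [incl_gT h]; exact (tT_gT_comm (by omega) (by omega)).symm
  | ht j h => rw [incl_tT h]; exact tT_comm _ _
  | hadd a b ha hb => rw [map_add]; exact ha.add_left hb
  | hmul a b ha hb => rw [map_mul]; exact ha.mul_left hb

/-- The generators of Y_{d,n} live on the strands 0, …, n-1, while g_n exchanges the strands n and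
n+1. -/
theorem incl_incl_commute_gT (a : YH d n u) :
    Commute (incl d (n + 1) u (incl d n u a)) (gT d (n + 2) u n) := by
  induction a using YH_induction with
  | halg r => simp only [AlgHom.commutes]; exact Algebra.commutes r _
  | hg i h => rw [incl_gT h, incl_gT (by omega)]; exact gT_comm h
  | ht j h => rw [incl_tT h, incl_tT (by omega)]; exact tT_gT_comm (by omega) (by omega)
  | hadd a b ha hb => rw [map_add, map_add]; exact ha.add_left hb
  | hmul a b ha hb => rw [map_mul, map_mul]; exact ha.mul_left hb

end YokonumaHecke

/-! ### The right action of Y_{d,n+1} on coordinate rows -/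

namespace YokonumaHecke

section BraidEntries

variable {B : Type*} [Ring B] [Algebra ℂ B] {p : ℂ} {h E E' e : B}

/-- This and the next two identities are the braid relation at the entries i, i+1, i+2 of a row.
There x, y, w are the entries of the row, h is g_i, e is e_i, and E, E' are the averages of t_i and
t_{i+1} with τ. -/
theorem braid_entry_fst (e2 : E' * h = h * E) (e3 : E' * e = E * E')
    (e5 : h * h = 1 + p • e + p • (e * h)) (x y w : B) :
    p • ((p • (x * E) + y) * h * E) + (p • ((x + p • (x * E)) * E') + w * h)
      = (p • (x * h * E) + (p • (y * E') + w)) * h := by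
  have e6 : x * h * E * h = x * E' + p • (x * E * E') + p • (x * E * E' * h) := by
    rw [mul_assoc x, ← e2, ← mul_assoc, mul_assoc, e5, mul_assoc x, mul_add, mul_add,
      mul_smul_comm, mul_smul_comm, ← mul_assoc E', e3]
    simp only [mul_add, mul_smul_comm, mul_assoc, mul_one, e3]
  have e7 : x * E * h * E = x * E * E' * h := by rw [mul_assoc, ← e2, mul_assoc, mul_assoc, mul_assoc]
  have e8 : y * h * E = y * E' * h := by rw [mul_assoc, ← e2, mul_assoc]
  simp only [add_mul, smul_mul_assoc, e6, e7, e8]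
  module

theorem braid_entry_snd (e1 : E * h = h * E') (e2 : E' * h = h * E) (e4 : Commute E' E) (x y : B) :
    (p • (x * E) + y) * h + p • ((p • (x * E) + y) * h * E)
      = p • ((x * h + p • (x * h * E)) * E') + (y + p • (y * E')) * h := by
  have e6 : x * E * h = x * h * E' := by rw [mul_assoc, e1, mul_assoc]
  have e7 : x * h * E' * E = x * h * E * E' := by rw [mul_assoc, e4.eq, ← mul_assoc]
  have e8 : y * h * E = y * E' * h := by rw [mul_assoc, ← e2, mul_assoc]
  simp only [add_mul, smul_mul_assoc, e6, e7, e8]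
  module

theorem braid_entry_trd (e1 : E * h = h * E') (e2 : E' * h = h * E) (e4 : Commute E' E) (x : B) :
    (x + p • (x * E) + p • ((x + p • (x * E)) * E')) * h
      = x * h + p • (x * h * E) + p • ((x * h + p • (x * h * E)) * E') := by
  have e6 : x * E * h = x * h * E' := by rw [mul_assoc, e1, mul_assoc]
  have e7 : x * E' * h = x * h * E := by rw [mul_assoc, e2, mul_assoc]
  have e8 : x * E * E' * h = x * h * E * E' := by
    rw [mul_assoc x, ← e4.eq, mul_assoc, mul_assoc, e1, ← mul_assoc E', e2]
    simp only [mul_assoc]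
  simp only [add_mul, smul_mul_assoc, e6, e7, e8]
  module

end BraidEntries

section Rows

variable {d n : ℕ} {u : ℂ} {B : Type*} [Ring B] [Algebra ℂ B]
  (ι : YH d n u →ₐ[ℂ] B) (τ : B)

/-- The right action of `g_j ∈ Y_{d,n+1}(u)` on rows of length `n + 1` over `B`. -/
noncomputable def rowG (j : ℕ) (h : j + 1 < n + 1) : Module.End ℂ (Fin (n + 1) → B) where
  toFun f l :=
    if l.val < j then f l * ι (gT d n u (j - 1))
    else if l.val = j then
      (u - 1) • (f ⟨j, by omega⟩ * avg d (ι (tT d n u j)) τ) + f ⟨j + 1, h⟩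
    else if l.val = j + 1 then
      f ⟨j, by omega⟩ + (u - 1) • (f ⟨j, by omega⟩ * avg d (ι (tT d n u j)) τ)
    else f l * ι (gT d n u j)
  map_add' f f' := by
    ext l
    simp only [Pi.add_apply, add_mul, smul_add]
    split_ifs <;> abel
  map_smul' c f := by
    ext l
    simp only [Pi.smul_apply, smul_mul_assoc, RingHom.id_apply, smul_comm (u - 1) c]
    split_ifs <;> simp only [smul_add]

/-- The diagonal entries of the right action of `t_j ∈ Y_{d,n+1}(u)` on rows over `B`. -/
noncomputable def diagT (j : ℕ) : Fin (n + 1) → B := fun l =>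
  if l.val < j then ι (tT d n u (j - 1)) else if l.val = j then τ else ι (tT d n u j)

variable {ι τ}

/-- The four rules record w_l g_j. It is g_{j-1} w_l for l < j by the braid relation, g_j w_l for l
> j + 1, and w_j for l = j + 1. For l = j it is w_{j+1} g_j²: the quadratic relation applies, and
e_j moved to the left of w_{j+1} becomes the average of t_j and τ. -/
theorem rowG_lt {j : ℕ} (h : j + 1 < n + 1) (f : Fin (n + 1) → B) {l : ℕ} (hl : l < n + 1)
    (hlj : l < j) : rowG ι τ j h f ⟨l, hl⟩ = f ⟨l, hl⟩ * ι (gT d n u (j - 1)) := by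
  simp [rowG, hlj]

theorem rowG_self {j : ℕ} (h : j + 1 < n + 1) (f : Fin (n + 1) → B) (hl : j < n + 1) :
    rowG ι τ j h f ⟨j, hl⟩
      = (u - 1) • (f ⟨j, hl⟩ * avg d (ι (tT d n u j)) τ) + f ⟨j + 1, h⟩ := by
  simp [rowG]

theorem rowG_succ {j : ℕ} (h : j + 1 < n + 1) (f : Fin (n + 1) → B) :
    rowG ι τ j h f ⟨j + 1, h⟩
      = f ⟨j, by omega⟩ + (u - 1) • (f ⟨j, by omega⟩ * avg d (ι (tT d n u j)) τ) := by
  simp [rowG]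

theorem rowG_gt {j : ℕ} (h : j + 1 < n + 1) (f : Fin (n + 1) → B) {l : ℕ} (hl : l < n + 1)
    (hlj : j + 1 < l) : rowG ι τ j h f ⟨l, hl⟩ = f ⟨l, hl⟩ * ι (gT d n u j) := by
  simp [rowG, show ¬ l < j by omega, show l ≠ j by omega, show l ≠ j + 1 by omega]

/-- Similarly w_l t_j is t_{j-1} w_l, t_n w_l or t_j w_l according as l < j, l = j or l > j, with τ
standing for t_n. -/
theorem diagT_lt {j l : ℕ} (hl : l < n + 1) (hlj : l < j) :
    diagT ι τ j ⟨l, hl⟩ = ι (tT d n u (j - 1)) := by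
  simp [diagT, hlj]

theorem diagT_self {j : ℕ} (hl : j < n + 1) : diagT ι τ j ⟨j, hl⟩ = τ := by
  simp [diagT]

theorem diagT_gt {j l : ℕ} (hl : l < n + 1) (hlj : j < l) :
    diagT ι τ j ⟨l, hl⟩ = ι (tT d n u j) := by
  simp [diagT, show ¬ l < j by omega, show l ≠ j by omega]

variable (hc : ∀ b, Commute τ b) (hτ : τ ^ d = 1)

include hc in
theorem avg_tT_mul_gT {j : ℕ} (h : j + 1 < n) :
    avg d (ι (tT d n u j)) τ * ι (gT d n u j)
      = ι (gT d n u j) * avg d (ι (tT d n u (j + 1))) τ :=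
  avg_mul_of_mul_eq (by rw [← map_mul, tT_mul_gT_left h, map_mul]) (hc _)

include hc in
theorem avg_tT_succ_mul_gT {j : ℕ} (h : j + 1 < n) :
    avg d (ι (tT d n u (j + 1))) τ * ι (gT d n u j)
      = ι (gT d n u j) * avg d (ι (tT d n u j)) τ :=
  avg_mul_of_mul_eq (by rw [← map_mul, tT_mul_gT_right h, map_mul]) (hc _)

include hc in
theorem avg_tT_commute_gT {i j : ℕ} (h0 : j ≠ i) (h1 : j ≠ i + 1) :
    Commute (avg d (ι (tT d n u j)) τ) (ι (gT d n u i)) :=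
  commute_avg ((tT_gT_comm h0 h1).map ι) (hc _)

include hc in
theorem avg_tT_commute_tT (i j : ℕ) :
    Commute (avg d (ι (tT d n u j)) τ) (ι (tT d n u i)) :=
  commute_avg ((tT_comm _ _).map ι) (hc _)

include hc in
theorem avg_tT_commute_avg (i j : ℕ) :
    Commute (avg d (ι (tT d n u j)) τ) (avg d (ι (tT d n u i)) τ) :=
  commute_avg (avg_tT_commute_tT hc j i).symm (hc _)

theorem map_tT_pow (j : ℕ) : ι (tT d n u j) ^ d = 1 := by rw [← map_pow, tT_pow, map_one]

include hc hτ in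
-- For the three commuting elements t_j, t_{j+1}, τ, any two of the pairwise averages have the same
-- product: it forces all three elements to coincide.
theorem avg_mul_map_eT (j : ℕ) :
    avg d (ι (tT d n u (j + 1))) τ * ι (eT d n u j)
      = avg d (ι (tT d n u j)) τ * avg d (ι (tT d n u (j + 1))) τ := by
  have h0 := map_tT_pow (ι := ι) j
  have h1 := map_tT_pow (ι := ι) (j + 1)
  have hcomm := (tT_comm (d := d) (n := n) (u := u) j (j + 1)).map ι
  rw [eT, map_avg, (avg_tT_commute_avg hc j (j + 1)).symm.eq, avg_symm hcomm h0 h1,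
    avg_symm (hc _).symm h1 hτ, avg_symm (hc _).symm h0 hτ]
  have e1 := avg_mul_avg_swap (c := ι (tT d n u j)) (hc (ι (tT d n u (j + 1)))) hτ h1
  rw [e1]

include hc in
theorem rowG_comm {i j : ℕ} (hi : i + 1 < n + 1) (hj : j + 1 < n + 1) (hij : i + 1 < j) :
    rowG ι τ j hj * rowG ι τ i hi = rowG ι τ i hi * rowG ι τ j hj := by
  refine LinearMap.ext fun f => funext fun ⟨l, hl⟩ => ?_
  simp only [Module.End.mul_apply]
  have c1 : ∀ {a b : ℕ}, a + 1 < b → ι (gT d n u a) * ι (gT d n u b)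
      = ι (gT d n u b) * ι (gT d n u a) := fun h => ((gT_comm h).map ι).eq
  have c2 : avg d (ι (tT d n u i)) τ * ι (gT d n u (j - 1))
      = ι (gT d n u (j - 1)) * avg d (ι (tT d n u i)) τ :=
    avg_tT_commute_gT hc (by omega) (by omega)
  have c3 : avg d (ι (tT d n u j)) τ * ι (gT d n u i)
      = ι (gT d n u i) * avg d (ι (tT d n u j)) τ :=
    avg_tT_commute_gT hc (by omega) (by omega)
  obtain h | h | h | h | h | h | h : l < i ∨ l = i ∨ l = i + 1 ∨ (i + 1 < l ∧ l < j) ∨ l = j ∨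
      l = j + 1 ∨ j + 1 < l := by omega
  · simp (disch := omega) only [rowG_lt, mul_assoc]
    rw [c1 (by omega)]
  · subst h
    simp (disch := omega) only [rowG_lt, rowG_self, mul_assoc, add_mul, smul_mul_assoc, c2]
  · subst h
    simp (disch := omega) only [rowG_lt, rowG_succ, mul_assoc, add_mul, smul_mul_assoc, c2]
  · simp (disch := omega) only [rowG_lt, rowG_gt, mul_assoc]
    rw [c1 (by omega)]
  · subst h
    simp (disch := omega) only [rowG_gt, rowG_self, mul_assoc, add_mul, smul_mul_assoc, c3]
  · subst h
    simp (disch := omega) only [rowG_gt, rowG_succ, mul_assoc, add_mul, smul_mul_assoc, c3]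
  · simp (disch := omega) only [rowG_gt, mul_assoc]
    rw [c1 (by omega)]

include hc hτ in
theorem rowG_braid {i : ℕ} (hi : i + 1 < n + 1) (hi' : i + 1 + 1 < n + 1) :
    rowG ι τ i hi * rowG ι τ (i + 1) hi' * rowG ι τ i hi
      = rowG ι τ (i + 1) hi' * rowG ι τ i hi * rowG ι τ (i + 1) hi' := by
  refine LinearMap.ext fun f => funext fun ⟨l, hl⟩ => ?_
  simp only [Module.End.mul_apply]
  have br : ∀ {i : ℕ}, i + 2 < n → ι (gT d n u i) * (ι (gT d n u (i + 1)) * ι (gT d n u i))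
      = ι (gT d n u (i + 1)) * (ι (gT d n u i) * ι (gT d n u (i + 1))) := fun h => by
    simp only [← map_mul, ← mul_assoc, gT_braid h]
  have e1 := avg_tT_mul_gT (ι := ι) hc (by omega : i + 1 < n)
  have e2 := avg_tT_succ_mul_gT (ι := ι) hc (by omega : i + 1 < n)
  have e3 := avg_mul_map_eT (ι := ι) hc hτ i
  have e4 := avg_tT_commute_avg (ι := ι) hc i (i + 1)
  have e5 : ι (gT d n u i) * ι (gT d n u i) = 1 + (u - 1) • ι (eT d n u i)
      + (u - 1) • (ι (eT d n u i) * ι (gT d n u i)) := by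
    rw [← map_mul, gT_sq (by omega)]; simp
  -- Away from the entries i, i+1, i+2 both sides are multiplication by the two sides of a braid
  -- relation of Y_{d,n}, with indices lowered by one when l < i.
  obtain h | h | h | h | h : l < i ∨ l = i ∨ l = i + 1 ∨ l = i + 2 ∨ i + 2 < l := by omega
  · obtain ⟨k, rfl⟩ : ∃ k, i = k + 1 := ⟨i - 1, by omega⟩
    simp (disch := omega) only [rowG_lt, mul_assoc, Nat.add_sub_cancel]
    rw [br (by omega)]
  · subst h
    simp (disch := omega) only [rowG_gt, rowG_lt, rowG_self, rowG_succ, Nat.add_sub_cancel]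
    exact braid_entry_fst e2 e3 e5 _ _ _
  · subst h
    simp (disch := omega) only [rowG_gt, rowG_lt, rowG_self, rowG_succ, Nat.add_sub_cancel]
    exact braid_entry_snd e1 e2 e4 _ _
  · subst h
    simp (disch := omega) only [rowG_gt, rowG_lt, rowG_succ, Nat.add_sub_cancel]
    exact braid_entry_trd e1 e2 e4 _
  · simp (disch := omega) only [rowG_gt, mul_assoc]
    rw [br (by omega)]

variable (ι τ) in
/-- The right action of `t_j ∈ Y_{d,n+1}(u)` on rows of length `n + 1` over `B`. -/
noncomputable def rowT (j : ℕ) : Module.End ℂ (Fin (n + 1) → B) :=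
  LinearMap.mulRight ℂ (diagT ι τ j)

theorem rowT_apply (j : ℕ) (f : Fin (n + 1) → B) (l : Fin (n + 1)) :
    rowT ι τ j f l = f l * diagT ι τ j l := rfl

include hc in
theorem diagT_comm (i j : ℕ) : Commute (diagT ι τ i) (diagT ι τ j) := by
  have h : ∀ a b, ι (tT d n u a) * ι (tT d n u b) = ι (tT d n u b) * ι (tT d n u a) :=
    fun a b => ((tT_comm a b).map ι).eq
  refine funext fun l => ?_
  simp only [Pi.mul_apply, diagT]
  split_ifs <;> first | rfl | exact h _ _ | exact (hc _).eq | exact (hc _).symm.eq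

include hτ in
theorem diagT_pow (j : ℕ) : (diagT ι τ j : Fin (n + 1) → B) ^ d = 1 := by
  refine funext fun l => ?_
  simp only [Pi.pow_apply, diagT]
  split_ifs <;> simp [hτ, map_tT_pow]

include hc in
theorem rowG_mul_rowT {i j : ℕ} (h : i + 1 < n + 1) (h0 : j ≠ i) (h1 : j ≠ i + 1) :
    rowG ι τ i h * rowT ι τ j = rowT ι τ j * rowG ι τ i h := by
  refine LinearMap.ext fun f => funext fun ⟨l, hl⟩ => ?_
  simp only [Module.End.mul_apply]
  have c1 : ∀ {a b : ℕ}, b ≠ a → b ≠ a + 1 → ι (tT d n u b) * ι (gT d n u a)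
      = ι (gT d n u a) * ι (tT d n u b) := fun h h' => ((tT_gT_comm h h').map ι).eq
  have c2 : ∀ b, avg d (ι (tT d n u i)) τ * ι (tT d n u b)
      = ι (tT d n u b) * avg d (ι (tT d n u i)) τ := fun b => (avg_tT_commute_tT hc b i).eq
  have c3 : ∀ b, τ * ι b = ι b * τ := fun b => hc _
  obtain h2 | h2 : j < i ∨ i + 1 < j := by omega
  · obtain h | h | h | h | h | h : l < j ∨ l = j ∨ (j < l ∧ l < i) ∨ l = i ∨ l = i + 1 ∨
        i + 1 < l := by omega
    · simp (disch := omega) only [rowG_lt, rowT_apply, diagT_lt, mul_assoc, c1]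
    · subst h
      simp (disch := omega) only [rowG_lt, rowT_apply, diagT_self, mul_assoc, c3]
    · simp (disch := omega) only [rowG_lt, rowT_apply, diagT_gt, mul_assoc, c1]
    · subst h
      simp (disch := omega) only [rowG_self, rowT_apply, diagT_gt, mul_assoc, c2, add_mul,
        smul_mul_assoc]
    · subst h
      simp (disch := omega) only [rowG_succ, rowT_apply, diagT_gt, mul_assoc, c2, add_mul,
        smul_mul_assoc]
    · simp (disch := omega) only [rowG_gt, rowT_apply, diagT_gt, mul_assoc, c1]
  · obtain h | h | h | h | h | h : l < i ∨ l = i ∨ l = i + 1 ∨ (i + 1 < l ∧ l < j) ∨ l = j ∨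
        j < l := by omega
    · simp (disch := omega) only [rowG_lt, rowT_apply, diagT_lt, mul_assoc, c1]
    · subst h
      simp (disch := omega) only [rowG_self, rowT_apply, diagT_lt, mul_assoc, c2, add_mul,
        smul_mul_assoc]
    · subst h
      simp (disch := omega) only [rowG_succ, rowT_apply, diagT_lt, mul_assoc, c2, add_mul,
        smul_mul_assoc]
    · simp (disch := omega) only [rowG_gt, rowT_apply, diagT_lt, mul_assoc, c1]
    · subst h
      simp (disch := omega) only [rowG_gt, rowT_apply, diagT_self, mul_assoc, c3]
    · simp (disch := omega) only [rowG_gt, rowT_apply, diagT_gt, mul_assoc, c1]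

theorem map_tT_mul_gT_left {i : ℕ} (h : i + 1 < n) :
    ι (tT d n u i) * ι (gT d n u i) = ι (gT d n u i) * ι (tT d n u (i + 1)) := by
  simp only [← map_mul, tT_mul_gT_left h]

theorem map_tT_mul_gT_right {i : ℕ} (h : i + 1 < n) :
    ι (tT d n u (i + 1)) * ι (gT d n u i) = ι (gT d n u i) * ι (tT d n u i) := by
  simp only [← map_mul, tT_mul_gT_right h]

include hc hτ in
theorem rowG_mul_rowT_left {i : ℕ} (h : i + 1 < n + 1) :
    rowG ι τ i h * rowT ι τ i = rowT ι τ (i + 1) * rowG ι τ i h := by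
  refine LinearMap.ext fun f => funext fun ⟨l, hl⟩ => ?_
  simp only [Module.End.mul_apply]
  have c2 : avg d (ι (tT d n u i)) τ * ι (tT d n u i)
      = ι (tT d n u i) * avg d (ι (tT d n u i)) τ := (avg_tT_commute_tT hc i i).eq
  have c3 : τ * avg d (ι (tT d n u i)) τ = ι (tT d n u i) * avg d (ι (tT d n u i)) τ :=
    (mul_avg (hc _).symm (map_tT_pow i) hτ).symm
  obtain h | h | h | h : l < i ∨ l = i ∨ l = i + 1 ∨ i + 1 < l := by omega
  · obtain ⟨k, rfl⟩ : ∃ k, i = k + 1 := ⟨i - 1, by omega⟩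
    simp (disch := omega) only [rowG_lt, rowT_apply, diagT_lt, mul_assoc, Nat.add_sub_cancel,
      map_tT_mul_gT_left]
  · subst h
    simp (disch := omega) only [rowG_self, rowT_apply, diagT_lt, diagT_self, diagT_gt, mul_assoc,
      add_mul, smul_mul_assoc, Nat.add_sub_cancel, c2, c3]
  · subst h
    simp (disch := omega) only [rowG_succ, rowT_apply, diagT_self, mul_assoc, add_mul,
      smul_mul_assoc, (hc _).eq]
  · simp (disch := omega) only [rowG_gt, rowT_apply, diagT_gt, mul_assoc, map_tT_mul_gT_left]

include hc hτ in
theorem rowG_mul_rowT_right {i : ℕ} (h : i + 1 < n + 1) :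
    rowG ι τ i h * rowT ι τ (i + 1) = rowT ι τ i * rowG ι τ i h := by
  refine LinearMap.ext fun f => funext fun ⟨l, hl⟩ => ?_
  simp only [Module.End.mul_apply]
  have c2 : avg d (ι (tT d n u i)) τ * ι (tT d n u i)
      = ι (tT d n u i) * avg d (ι (tT d n u i)) τ := (avg_tT_commute_tT hc i i).eq
  have c4 : avg d (ι (tT d n u i)) τ * τ = ι (tT d n u i) * avg d (ι (tT d n u i)) τ := by
    rw [← c2, avg_mul (hc _).symm (map_tT_pow i) hτ]
  obtain h | h | h | h : l < i ∨ l = i ∨ l = i + 1 ∨ i + 1 < l := by omega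
  · obtain ⟨k, rfl⟩ : ∃ k, i = k + 1 := ⟨i - 1, by omega⟩
    simp (disch := omega) only [rowG_lt, rowT_apply, diagT_lt, mul_assoc, Nat.add_sub_cancel,
      map_tT_mul_gT_right]
  · subst h
    simp (disch := omega) only [rowG_self, rowT_apply, diagT_lt, diagT_self, mul_assoc,
      add_mul, smul_mul_assoc, Nat.add_sub_cancel, c4]
  · subst h
    simp (disch := omega) only [rowG_succ, rowT_apply, diagT_lt, diagT_gt, mul_assoc,
      add_mul, smul_mul_assoc, Nat.add_sub_cancel, c2]
  · simp (disch := omega) only [rowG_gt, rowT_apply, diagT_gt, mul_assoc, map_tT_mul_gT_right]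

theorem avg_diagT_apply (i j : ℕ) (l : Fin (n + 1)) :
    avg d (diagT ι τ i) (diagT ι τ j) l = avg d (diagT ι τ i l) (diagT ι τ j l) :=
  map_avg (Pi.evalAlgHom ℂ (fun _ : Fin (n + 1) => B) l) _ _ _

theorem avg_diagT_lt {i l : ℕ} (hl : l < n + 1) (h : l < i) :
    avg d (diagT ι τ i) (diagT ι τ (i + 1)) ⟨l, hl⟩ = ι (eT d n u (i - 1)) := by
  obtain ⟨k, rfl⟩ : ∃ k, i = k + 1 := ⟨i - 1, by omega⟩
  simp (disch := omega) only [avg_diagT_apply, diagT_lt, Nat.add_sub_cancel, eT, map_avg]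

include hc hτ in
theorem avg_diagT_self {i : ℕ} (hl : i < n + 1) :
    avg d (diagT ι τ i) (diagT ι τ (i + 1)) ⟨i, hl⟩ = avg d (ι (tT d n u i)) τ := by
  simp (disch := omega) only [avg_diagT_apply, diagT_self, diagT_lt, Nat.add_sub_cancel]
  rw [avg_symm (hc _) hτ (map_tT_pow _)]

theorem avg_diagT_succ {i : ℕ} (hl : i + 1 < n + 1) :
    avg d (diagT ι τ i) (diagT ι τ (i + 1)) ⟨i + 1, hl⟩ = avg d (ι (tT d n u i)) τ := by
  rw [avg_diagT_apply, diagT_self, diagT_gt _ (by omega)]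

theorem avg_diagT_gt {i l : ℕ} (hl : l < n + 1) (h : i + 1 < l) :
    avg d (diagT ι τ i) (diagT ι τ (i + 1)) ⟨l, hl⟩ = ι (eT d n u i) := by
  rw [avg_diagT_apply, diagT_gt _ (by omega), diagT_gt _ (by omega), eT, map_avg]

include hc hτ in
theorem rowG_sq {i : ℕ} (h : i + 1 < n + 1) (f : Fin (n + 1) → B) :
    rowG ι τ i h (rowG ι τ i h f)
      = f + (u - 1) • (f * avg d (diagT ι τ i) (diagT ι τ (i + 1)))
        + (u - 1) • rowG ι τ i h (f * avg d (diagT ι τ i) (diagT ι τ (i + 1))) := by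
  have sq : ∀ {i : ℕ}, i + 1 < n → ι (gT d n u i) * ι (gT d n u i) = 1 + (u - 1) • ι (eT d n u i)
      + (u - 1) • (ι (eT d n u i) * ι (gT d n u i)) := fun h => by
    rw [← map_mul, gT_sq h]; simp
  refine funext fun ⟨l, hl⟩ => ?_
  simp only [Pi.add_apply, Pi.smul_apply, Pi.mul_apply]
  obtain h | h | h | h : l < i ∨ l = i ∨ l = i + 1 ∨ i + 1 < l := by omega
  · simp (disch := omega) only [rowG_lt, avg_diagT_lt, Pi.mul_apply, mul_assoc]
    rw [sq (by omega)]
    simp only [mul_add, mul_smul_comm, mul_one]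
  · subst h
    simp (disch := omega) only [rowG_self, rowG_succ, avg_diagT_self hc hτ, avg_diagT_succ,
      Pi.mul_apply, add_mul, smul_mul_assoc, smul_add]
    module
  · subst h
    simp (disch := omega) only [rowG_self, rowG_succ, avg_diagT_self hc hτ, avg_diagT_succ,
      Pi.mul_apply, add_mul, smul_mul_assoc, smul_add]
    module
  · simp (disch := omega) only [rowG_gt, avg_diagT_gt, Pi.mul_apply, mul_assoc]
    rw [sq (by omega)]
    simp only [mul_add, mul_smul_comm, mul_one]

variable (ι τ) in
/-- The right action of the generators of `Y_{d,n+1}(u)` on rows over `B`. -/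
noncomputable def rowGen : Gen (n + 1) → (Module.End ℂ (Fin (n + 1) → B))ᵐᵒᵖ
  | Gen.g i h => MulOpposite.op (rowG ι τ i h)
  | Gen.t j => MulOpposite.op (rowT ι τ j)

/-- Right multiplication as an algebra homomorphism to the opposite of the endomorphism ring. -/
noncomputable def rmulHom (C : Type*) [Ring C] [Algebra ℂ C] : C →ₐ[ℂ] (Module.End ℂ C)ᵐᵒᵖ where
  toFun c := MulOpposite.op (LinearMap.mulRight ℂ c)
  map_one' := by simp; rfl
  map_mul' a b := by rw [← MulOpposite.op_mul, LinearMap.mulRight_mul]; rfl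
  map_zero' := by simp
  map_add' a b := by rw [← MulOpposite.op_add]; congr 1; ext; simp [mul_add]
  commutes' r := by
    rw [MulOpposite.algebraMap_apply]; congr 1; ext x
    simp [← Algebra.commutes, Algebra.smul_def]

include hc hτ in
-- The target is the opposite endomorphism ring because the action is on the right: in a product the
-- leftmost factor acts first.
theorem rowGen_rel ⦃a b : FreeAlgebra ℂ (Gen (n + 1))⦄ (hab : Rel d (n + 1) u a b) :
    FreeAlgebra.lift ℂ (rowGen ι τ) a = FreeAlgebra.lift ℂ (rowGen ι τ) b := by
  have hT : ∀ j, MulOpposite.op (rowT ι τ j) = rmulHom _ (diagT ι τ j) := fun j => rfl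
  cases hab with
  | g_comm i j hi hj hij =>
    simp only [map_mul, FreeAlgebra.lift_ι_apply, rowGen, ← MulOpposite.op_mul]
    rw [rowG_comm hc hi hj hij]
  | g_braid i hi hi' =>
    simp only [map_mul, FreeAlgebra.lift_ι_apply, rowGen, ← MulOpposite.op_mul]
    rw [← mul_assoc, ← mul_assoc, rowG_braid hc hτ hi hi']
  | t_comm i j =>
    simp only [map_mul, FreeAlgebra.lift_ι_apply, rowGen, hT]
    rw [← map_mul, ← map_mul, (diagT_comm hc _ _).eq]
  | t_g i hi j =>
    simp only [map_mul, FreeAlgebra.lift_ι_apply, rowGen, ← MulOpposite.op_mul]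
    congr 1
    by_cases h0 : j = ⟨i, by omega⟩
    · rw [h0, sw, Equiv.swap_apply_left, rowG_mul_rowT_left hc hτ hi]
    · by_cases h1 : j = ⟨i + 1, hi⟩
      · rw [h1, sw, Equiv.swap_apply_right, rowG_mul_rowT_right hc hτ hi]
      · rw [sw, Equiv.swap_apply_of_ne_of_ne h0 h1,
          rowG_mul_rowT hc hi (fun h => h0 (Fin.ext h)) (fun h => h1 (Fin.ext h))]
  | t_pow j =>
    simp only [map_pow, map_one, FreeAlgebra.lift_ι_apply, rowGen, hT]
    rw [← map_pow, diagT_pow hτ, map_one]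
  | g_sq i hi =>
    have hE : FreeAlgebra.lift ℂ (rowGen ι τ) (freeE d i hi)
        = rmulHom _ (avg d (diagT ι τ i) (diagT ι τ (i + 1))) := by
      rw [map_avg, avg, freeE]
      simp only [map_smul, map_sum, map_mul, map_pow, FreeAlgebra.lift_ι_apply, rowGen, hT]
    simp only [map_mul, map_pow, map_one, map_add, map_smul, FreeAlgebra.lift_ι_apply, rowGen, hE]
    refine MulOpposite.unop_injective (LinearMap.ext fun f => ?_)
    rw [sq]
    exact rowG_sq hc hτ hi f

variable (ι) in
/-- The right action of `Y_{d,n+1}(u)` on rows of length `n + 1` over `B`. -/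
noncomputable def rowHom : YH d (n + 1) u →ₐ[ℂ] (Module.End ℂ (Fin (n + 1) → B))ᵐᵒᵖ :=
  RingQuot.liftAlgHom ℂ ⟨FreeAlgebra.lift ℂ (rowGen ι τ), rowGen_rel hc hτ⟩

theorem rowHom_gT {i : ℕ} (h : i + 1 < n + 1) :
    rowHom ι hc hτ (gT d (n + 1) u i) = MulOpposite.op (rowG ι τ i h) := by
  rw [gT_eq h]
  simp [rowHom, g, rowGen]

theorem rowHom_tT {j : ℕ} (h : j < n + 1) :
    rowHom ι hc hτ (tT d (n + 1) u j) = MulOpposite.op (rowT ι τ j) := by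
  rw [tT_eq h]
  simp [rowHom, t, rowGen]

end Rows
end YokonumaHecke

/-! ### Spanning set of Y_{d,n+1} over Y_{d,n} -/

namespace YokonumaHecke

variable {d n : ℕ} {u : ℂ}

theorem map_eT_commute_gT {i : ℕ} (h : i + 1 < n) : Commute (eT d n u i) (gT d n u i) := by
  have h1 := avg_mul_of_mul_eq (d := d) (tT_mul_gT_left (d := d) (u := u) h) (tT_mul_gT_right h)
  rw [avg_symm (tT_comm (i + 1) i) (tT_pow _) (tT_pow _)] at h1
  exact h1

theorem gT_mul_tT_pow {i : ℕ} (h : i + 1 < n) (m : ℕ) :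
    gT d n u i * tT d n u i ^ m = tT d n u (i + 1) ^ m * gT d n u i :=
  (pow_mul_eq_of_mul_eq (tT_mul_gT_right h) m).symm

theorem gT_mul_tT_succ_pow {i : ℕ} (h : i + 1 < n) (m : ℕ) :
    gT d n u i * tT d n u (i + 1) ^ m = tT d n u i ^ m * gT d n u i :=
  (pow_mul_eq_of_mul_eq (tT_mul_gT_left h) m).symm

/-- Here g and k play neighbouring braid generators, and c, c' lie low enough to commute with g. The
braid relation then turns two occurrences of g into one. -/
theorem mul_braid_mul {M : Type*} [Semigroup M] {g k c c' : M} (h : k * g * k = g * k * g)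
    (hc : c * g = g * c) (hc' : c' * g = g * c') (a : M) :
    a * g * (c * k * c') * g = a * c * k * g * (k * c') :=
  calc a * g * (c * k * c') * g = a * (g * c) * k * (c' * g) := by simp only [mul_assoc]
    _ = a * c * (g * k * g) * c' := by rw [hc', ← hc]; simp only [mul_assoc]
    _ = a * c * k * g * (k * c') := by rw [← h]; simp only [mul_assoc]

variable (d n u) in
/-- The additive span of the elements `a t_{n+1}^m` with `a ∈ Y_{d,n}(u)`. -/
noncomputable def spanT : AddSubmonoid (YH d (n + 1) u) :=
  AddSubmonoid.closure {y | ∃ a m, y = incl d n u a * tT d (n + 1) u n ^ m}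

variable (d n u) in
/-- The additive span of the elements `a t_{n+1}^m` and `a g_n b` with `a, b ∈ Y_{d,n}(u)`. -/
noncomputable def spanTG : AddSubmonoid (YH d (n + 1) u) :=
  spanT d n u ⊔ AddSubmonoid.closure
    {y | ∃ i a b, i + 1 = n ∧ y = incl d n u a * gT d (n + 1) u i * incl d n u b}

theorem mul_mem_of_closure {M : Type*} [NonUnitalNonAssocSemiring M] {s : Set M} {S : AddSubmonoid M} {b : M}
    (h : ∀ y ∈ s, y * b ∈ S) : ∀ y ∈ AddSubmonoid.closure s, y * b ∈ S := by
  intro y hy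
  induction hy using AddSubmonoid.closure_induction with
  | mem y hy => exact h y hy
  | zero => simp
  | add y z _ _ hy hz => rw [add_mul]; exact add_mem hy hz

theorem mul_mem_spanTG_of {S : AddSubmonoid (YH d (n + 1) u)} {b : YH d (n + 1) u}
    (h1 : ∀ a m, incl d n u a * tT d (n + 1) u n ^ m * b ∈ S)
    (h2 : ∀ i a a', i + 1 = n → incl d n u a * gT d (n + 1) u i * incl d n u a' * b ∈ S)
    {y : YH d (n + 1) u} (hy : y ∈ spanTG d n u) : y * b ∈ S := by
  obtain ⟨y1, h3, y2, h4, rfl⟩ := AddSubmonoid.mem_sup.mp hy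
  rw [add_mul]
  refine add_mem (mul_mem_of_closure ?_ _ h3) (mul_mem_of_closure ?_ _ h4)
  · rintro _ ⟨a, m, rfl⟩; exact h1 a m
  · rintro _ ⟨i, a, a', hi, rfl⟩; exact h2 i a a' hi

theorem incl_mul_tT_pow_mem_spanT (a : YH d n u) (m : ℕ) :
    incl d n u a * tT d (n + 1) u n ^ m ∈ spanT d n u :=
  AddSubmonoid.subset_closure ⟨a, m, rfl⟩

theorem incl_mul_tT_pow_mem (a : YH d n u) (m : ℕ) :
    incl d n u a * tT d (n + 1) u n ^ m ∈ spanTG d n u :=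
  AddSubmonoid.mem_sup_left (incl_mul_tT_pow_mem_spanT a m)

theorem incl_mul_gT_mul_mem (i : ℕ) (a b : YH d n u) (hi : i + 1 = n) :
    incl d n u a * gT d (n + 1) u i * incl d n u b ∈ spanTG d n u :=
  AddSubmonoid.mem_sup_right (AddSubmonoid.subset_closure ⟨i, a, b, hi, rfl⟩)

theorem mul_incl_mem_spanT (b : YH d n u) {y : YH d (n + 1) u} (hy : y ∈ spanT d n u) :
    y * incl d n u b ∈ spanT d n u := by
  refine mul_mem_of_closure ?_ y hy
  rintro _ ⟨a, m, rfl⟩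
  rw [mul_assoc, ← ((incl_commute_tT b).pow_right m).eq, ← mul_assoc, ← map_mul]
  exact incl_mul_tT_pow_mem_spanT _ _

theorem mul_tT_mem_spanT {y : YH d (n + 1) u} (hy : y ∈ spanT d n u) :
    y * tT d (n + 1) u n ∈ spanT d n u := by
  refine mul_mem_of_closure ?_ y hy
  rintro _ ⟨a, m, rfl⟩
  rw [mul_assoc, ← pow_succ]
  exact incl_mul_tT_pow_mem_spanT _ _

theorem mul_smul_mem_spanT (r : ℂ) {y : YH d (n + 1) u} (hy : y ∈ spanT d n u) :
    r • y ∈ spanT d n u := by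
  have := mul_incl_mem_spanT (algebraMap ℂ _ r) hy
  rwa [AlgHom.commutes, ← Algebra.commutes, ← Algebra.smul_def] at this

theorem mul_incl_mem_spanTG (b : YH d n u) {y : YH d (n + 1) u} (hy : y ∈ spanTG d n u) :
    y * incl d n u b ∈ spanTG d n u := by
  refine mul_mem_spanTG_of (fun a m => ?_) (fun i a a' hi => ?_) hy
  · exact AddSubmonoid.mem_sup_left (mul_incl_mem_spanT b (incl_mul_tT_pow_mem_spanT a m))
  · rw [mul_assoc, ← map_mul]
    exact incl_mul_gT_mul_mem _ _ _ hi

theorem smul_mem_spanTG (r : ℂ) {y : YH d (n + 1) u} (hy : y ∈ spanTG d n u) :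
    r • y ∈ spanTG d n u := by
  have := mul_incl_mem_spanTG (algebraMap ℂ _ r) hy
  rwa [AlgHom.commutes, ← Algebra.commutes, ← Algebra.smul_def] at this

theorem mul_tT_mem_spanTG {y : YH d (n + 1) u} (hy : y ∈ spanTG d n u) :
    y * tT d (n + 1) u n ∈ spanTG d n u := by
  refine mul_mem_spanTG_of (fun a m => ?_) (fun i a a' hi => ?_) hy
  · exact AddSubmonoid.mem_sup_left (mul_tT_mem_spanT (incl_mul_tT_pow_mem_spanT a m))
  · subst hi
    have h := gT_mul_tT_succ_pow (d := d) (u := u) (by omega : i + 1 < i + 1 + 1) 1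
    rw [pow_one, pow_one] at h
    rw [mul_assoc, (incl_commute_tT a').eq, ← mul_assoc, mul_assoc (incl d _ u a), h,
      ← mul_assoc, ← incl_tT (by omega : i < i + 1), ← map_mul]
    exact incl_mul_gT_mul_mem _ _ _ rfl

theorem mul_gT_mem_spanTG {i : ℕ} {y : YH d (i + 1 + 1) u} (hy : y ∈ spanT d (i + 1) u) :
    y * gT d (i + 1 + 1) u i ∈ spanTG d (i + 1) u := by
  refine mul_mem_of_closure ?_ y hy
  rintro _ ⟨a, m, rfl⟩
  rw [mul_assoc, ← gT_mul_tT_pow (by omega), ← mul_assoc, ← incl_tT (by omega : i < i + 1),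
    ← map_pow]
  exact incl_mul_gT_mul_mem _ _ _ rfl

theorem mul_gT_sq_mem_spanTG {i : ℕ} {y : YH d (i + 1 + 1) u} (hy : y ∈ spanT d (i + 1) u) :
    y * (gT d (i + 1 + 1) u i * gT d (i + 1 + 1) u i) ∈ spanTG d (i + 1) u := by
  have he : y * eT d (i + 1 + 1) u i ∈ spanT d (i + 1) u := by
    rw [eT, avg, mul_smul_comm, Finset.mul_sum]
    refine mul_smul_mem_spanT _ (sum_mem fun s _ => ?_)
    rw [← mul_assoc, ← incl_tT (by omega : i < i + 1), ← map_pow]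
    have h1 := mul_incl_mem_spanT (tT d (i + 1) u i ^ s) hy
    generalize y * incl d (i + 1) u (tT d (i + 1) u i ^ s) = w at h1
    induction (d - s) with
    | zero => simpa using h1
    | succ k ih => rw [pow_succ, ← mul_assoc]; exact mul_tT_mem_spanT ih
  rw [gT_sq (by omega), mul_add, mul_add, mul_one, mul_smul_comm, mul_smul_comm, ← mul_assoc]
  refine add_mem (add_mem ?_ ?_) ?_
  · exact AddSubmonoid.mem_sup_left hy
  · exact smul_mem_spanTG _ (AddSubmonoid.mem_sup_left he)
  · exact smul_mem_spanTG _ (mul_gT_mem_spanTG he)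

/-- The span contains 1, so stability under right multiplication by the generators suffices. The
critical product is a g a' g with g the last braid generator. By induction a' splits one level down:
for a' = c t^m the framing moves out and leaves g², and for a' = c g' c' the braid relation leaves a
single g. -/
theorem spanTG_eq_top : spanTG d n u = ⊤ := by
  induction n with
  | zero =>
    refine eq_top_iff.mpr fun y _ => ?_
    have key : ∀ b : YH d 1 u, ∀ y ∈ spanTG d 0 u, y * b ∈ spanTG d 0 u := fun b => by
      induction b using YH_induction with
      | halg r =>
        intro y hy
        rw [← Algebra.commutes, ← Algebra.smul_def]; exact smul_mem_spanTG r hy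
      | hg i h => omega
      | ht j h =>
        obtain rfl : j = 0 := by omega
        exact fun y hy => mul_tT_mem_spanTG hy
      | hadd a b ha hb => intro y hy; rw [mul_add]; exact add_mem (ha y hy) (hb y hy)
      | hmul a b ha hb => intro y hy; rw [← mul_assoc]; exact hb _ (ha y hy)
    simpa using key y 1 (by simpa using incl_mul_tT_pow_mem (1 : YH d 0 u) 0)
  | succ i ih =>
    refine eq_top_iff.mpr fun y _ => ?_
    have hg : ∀ y ∈ spanTG d (i + 1) u, y * gT d (i + 1 + 1) u i ∈ spanTG d (i + 1) u := by
      intro y hy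
      refine mul_mem_spanTG_of (fun a m => ?_) (fun i' a a' hi => ?_) hy
      · exact mul_gT_mem_spanTG (incl_mul_tT_pow_mem_spanT _ _)
      · obtain rfl : i' = i := by omega
        have ha' : a' ∈ spanTG d i' u := by rw [ih]; trivial
        have hS : ∀ {s : Set (YH d (i' + 1) u)}, (∀ b ∈ s, ∀ a, incl d _ u a * gT d _ u i' * incl d _ u b *
            gT d (i' + 1 + 1) u i' ∈ spanTG d (i' + 1) u) → ∀ b ∈ AddSubmonoid.closure s,
            ∀ a, incl d _ u a * gT d _ u i' * incl d _ u b *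
            gT d (i' + 1 + 1) u i' ∈ spanTG d (i' + 1) u := by
          intro s hs b hb
          induction hb using AddSubmonoid.closure_induction with
          | mem b hb => exact hs b hb
          | zero => simp
          | add b b' _ _ h1 h2 =>
            intro a
            rw [map_add, mul_add, add_mul]; exact add_mem (h1 a) (h2 a)
        obtain ⟨b1, h1, b2, h2, rfl⟩ := AddSubmonoid.mem_sup.mp ha'
        rw [map_add, mul_add, add_mul]
        refine add_mem (hS ?_ _ h1 a) (hS ?_ _ h2 a)
        · rintro _ ⟨c, m, rfl⟩ a
          have h3 := gT_mul_tT_pow (d := d) (u := u) (by omega : i' + 1 < i' + 1 + 1) m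
          rw [map_mul, map_pow, incl_tT (by omega), ← mul_assoc, mul_assoc (incl d _ u a),
            ← (incl_incl_commute_gT c).eq, ← mul_assoc, ← map_mul, mul_assoc (incl d _ u _) (gT d _ u i'),
            h3, ← mul_assoc, mul_assoc]
          exact mul_gT_sq_mem_spanTG (incl_mul_tT_pow_mem_spanT _ _)
        · rintro _ ⟨k, c, c', rfl, rfl⟩ a
          have h3 := gT_braid (d := d) (u := u) (by omega : k + 2 < k + 1 + 1 + 1)
          have h4 := (incl_incl_commute_gT (d := d) (u := u) c).eq
          have h5 := (incl_incl_commute_gT (d := d) (u := u) c').eq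
          have h6 : incl d _ u a * gT d _ u (k + 1)
              * incl d _ u (incl d _ u c * gT d _ u k * incl d _ u c') * gT d _ u (k + 1)
              = incl d _ u (a * incl d _ u c * gT d _ u k) * gT d _ u (k + 1)
                * incl d _ u (gT d _ u k * incl d _ u c') := by
            simp only [map_mul, incl_gT (by omega : k + 1 < k + 1 + 1)]
            exact mul_braid_mul h3 h4 h5 _
          rw [h6]
          exact incl_mul_gT_mul_mem _ _ _ rfl
    have key : ∀ b : YH d (i + 1 + 1) u, ∀ y ∈ spanTG d (i + 1) u, y * b ∈ spanTG d (i + 1) u :=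
      fun b => by
      induction b using YH_induction with
      | halg r =>
        intro y hy
        rw [← Algebra.commutes, ← Algebra.smul_def]; exact smul_mem_spanTG r hy
      | hg j h =>
        obtain rfl | h1 : j = i ∨ j < i := by omega
        · exact hg
        · rw [← incl_gT (by omega)]; exact fun y hy => mul_incl_mem_spanTG _ hy
      | ht j h =>
        obtain rfl | h1 : j = i + 1 ∨ j < i + 1 := by omega
        · exact fun y hy => mul_tT_mem_spanTG hy
        · rw [← incl_tT (by omega)]; exact fun y hy => mul_incl_mem_spanTG _ hy
      | hadd a b ha hb => intro y hy; rw [mul_add]; exact add_mem (ha y hy) (hb y hy)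
      | hmul a b ha hb => intro y hy; rw [← mul_assoc]; exact hb _ (ha y hy)
    simpa using key y 1 (by simpa using incl_mul_tT_pow_mem (1 : YH d (i + 1) u) 0)

/-- Scalars need no separate case, being absorbed in a. Writing `i + 1 = n` avoids n - 1 and makes
the braid case empty for n = 0. -/
theorem YH_succ_induction {P : YH d (n + 1) u → Prop} (hadd : ∀ y y', P y → P y' → P (y + y'))
    (ht : ∀ a m, P (incl d n u a * tT d (n + 1) u n ^ m))
    (hg : ∀ i a b, i + 1 = n → P (incl d n u a * gT d (n + 1) u i * incl d n u b))
    (y : YH d (n + 1) u) : P y := by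
  have h0 : P 0 := by simpa using ht 0 0
  have hy : y ∈ spanTG d n u := by rw [spanTG_eq_top]; trivial
  obtain ⟨y1, h3, y2, h4, rfl⟩ := AddSubmonoid.mem_sup.mp hy
  refine hadd _ _ (AddSubmonoid.closure_induction ?_ h0 (fun _ _ _ _ => hadd _ _) h3)
    (AddSubmonoid.closure_induction ?_ h0 (fun _ _ _ _ => hadd _ _) h4)
  · rintro _ ⟨a, m, rfl⟩; exact ht a m
  · rintro _ ⟨i, a, b, hi, rfl⟩; exact hg i a b hi

end YokonumaHecke

/-! ### Coordinates over the group algebra of ℤ/dℤ and the Markov extension of a functional -/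

namespace YokonumaHecke

section CyclicCoefficients

variable {d : ℕ} [NeZero d] {A V : Type*} [Ring A] [Algebra ℂ A]

/-- The linear map `∑ a_m τ^m ↦ ∑ φ_m(a_m)` on the group algebra of `ℤ/dℤ` over `A`. -/
noncomputable def sumCoeff [AddCommGroup V] [Module ℂ V] (φ : ZMod d → A →ₗ[ℂ] V) :
    AddMonoidAlgebra A (ZMod d) →ₗ[ℂ] V where
  toFun b := ∑ m, φ m (b.coeff m)
  map_add' b b' := by simp [Finset.sum_add_distrib]
  map_smul' r b := by simp [Finset.smul_sum]

theorem sumCoeff_single [AddCommGroup V] [Module ℂ V] (φ : ZMod d → A →ₗ[ℂ] V) (m : ZMod d)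
    (a : A) : sumCoeff φ (AddMonoidAlgebra.single m a) = φ m a := by
  change ∑ k, φ k ((AddMonoidAlgebra.single m a).coeff k) = _
  rw [Finset.sum_eq_single m]
  · simp
  · intro k _ hk
    simp [hk.symm]
  · simp

/-- The linear map `∑ a_m τ^m ↦ ∑ a_m w s^m`. -/
noncomputable def evalCoeff (w s : A) : AddMonoidAlgebra A (ZMod d) →ₗ[ℂ] A :=
  sumCoeff fun m => LinearMap.mulRight ℂ (w * s ^ m.val)

theorem evalCoeff_single (w s : A) (m : ZMod d) (a : A) :
    evalCoeff w s (AddMonoidAlgebra.single m a) = a * (w * s ^ m.val) :=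
  sumCoeff_single _ _ _

theorem evalCoeff_mul_single_zero {w s c c' : A} (h : c * w = w * c') (hs : Commute c' s)
    (b : AddMonoidAlgebra A (ZMod d)) :
    evalCoeff w s (b * AddMonoidAlgebra.single 0 c) = evalCoeff w s b * c' := by
  induction b using AddMonoidAlgebra.induction_linear with
  | zero => simp
  | add b b' hb hb' => rw [add_mul, map_add, hb, hb', map_add, add_mul]
  | single m a =>
    rw [AddMonoidAlgebra.single_mul_single, add_zero, evalCoeff_single, evalCoeff_single,
      mul_assoc a c, ← mul_assoc c, h, mul_assoc w, (hs.pow_right _).eq]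
    simp only [mul_assoc]

theorem pow_val_add_one {M : Type*} [Monoid M] {s : M} (hs : s ^ d = 1) (m : ZMod d) :
    s ^ (m + 1).val = s ^ m.val * s := by
  rw [ZMod.val_add, ← pow_eq_pow_mod _ hs, pow_add, ZMod.val_one_eq_one_mod,
    ← pow_eq_pow_mod _ hs, pow_one]

theorem evalCoeff_mul_single_one {w s : A} (hs : s ^ d = 1) (b : AddMonoidAlgebra A (ZMod d)) :
    evalCoeff w s (b * AddMonoidAlgebra.single 1 1) = evalCoeff w s b * s := by
  induction b using AddMonoidAlgebra.induction_linear with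
  | zero => simp
  | add b b' hb hb' => rw [add_mul, map_add, hb, hb', map_add, add_mul]
  | single m a =>
    rw [AddMonoidAlgebra.single_mul_single, mul_one, evalCoeff_single, evalCoeff_single,
      pow_val_add_one hs]
    simp only [mul_assoc]

end CyclicCoefficients

variable {d n : ℕ} {u : ℂ}

variable (d n u) in
/-- The product `g_{k+r-1} ⋯ g_{k+1} g_k`. -/
noncomputable def gProd (k : ℕ) : ℕ → YH d n u
  | 0 => 1
  | r + 1 => gT d n u (k + r) * gProd k r

theorem gProd_succ (k r : ℕ) : gProd d n u k (r + 1) = gProd d n u (k + 1) r * gT d n u k := by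
  induction r with
  | zero => simp [gProd]
  | succ r ih => rw [gProd, ih, gProd, mul_assoc, Nat.add_right_comm k 1 r, add_assoc]

theorem gProd_induction {P : YH d n u → Prop} (k r : ℕ) (h1 : P 1)
    (h : ∀ i a, k ≤ i → i < k + r → P a → P (gT d n u i * a)) : P (gProd d n u k r) := by
  induction r with
  | zero => exact h1
  | succ r ih =>
    exact h _ _ (by omega) (by omega) (ih fun i a h1 h2 => h i a h1 (by omega))

theorem gT_commute_gProd {j k : ℕ} (r : ℕ) (h : j + 1 < k) :
    Commute (gT d n u j) (gProd d n u k r) :=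
  gProd_induction (P := fun a => Commute (gT d n u j) a) k r (Commute.one_right _)
    fun _ _ h1 _ h3 => (gT_comm (by omega)).mul_right h3

theorem tT_commute_gProd {j k : ℕ} (r : ℕ) (h : j < k) :
    Commute (tT d n u j) (gProd d n u k r) :=
  gProd_induction (P := fun a => Commute (tT d n u j) a) k r (Commute.one_right _)
    fun _ _ h1 _ h3 => (tT_gT_comm (by omega) (by omega)).mul_right h3

theorem tT_commute_gProd_of_lt {j k r : ℕ} (h : k + r < j) :
    Commute (tT d n u j) (gProd d n u k r) :=
  gProd_induction (P := fun a => Commute (tT d n u j) a) k r (Commute.one_right _)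
    fun _ _ h1 _ h3 => (tT_gT_comm (by omega) (by omega)).mul_right h3

/-- Inside the descending product g_j meets g_{j+1} g_j; the braid relation releases g_{j+1} to the
right, and all other letters commute past. -/
theorem gT_mul_gProd {j k r : ℕ} (h0 : k ≤ j) (h1 : j + 1 < k + r) (hn : k + r < n) :
    gT d n u j * gProd d n u k r = gProd d n u k r * gT d n u (j + 1) := by
  induction r with
  | zero => omega
  | succ r ih =>
    obtain h | h : j + 1 < k + r ∨ j + 1 = k + r := by omega
    · rw [gProd, ← mul_assoc, (gT_comm h).eq, mul_assoc, ih h (by omega), mul_assoc]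
    · obtain ⟨r, rfl⟩ : ∃ r', r = r' + 1 := ⟨r - 1, by omega⟩
      obtain rfl : j = k + r := by omega
      have hc : Commute (gT d n u (k + r + 1)) (gProd d n u k r) :=
        gProd_induction (P := fun a => Commute (gT d n u (k + r + 1)) a) k r (Commute.one_right _)
          fun _ _ h1 _ h3 => (gT_comm (by omega)).symm.mul_right h3
      have hb := gT_braid (d := d) (u := u) (by omega : k + r + 2 < n)
      rw [gProd, gProd, ← add_assoc, ← mul_assoc, ← mul_assoc, hb, mul_assoc, hc.eq]
      simp only [mul_assoc]

theorem tT_mul_gProd {j k r : ℕ} (h0 : k ≤ j) (h1 : j < k + r) (hn : k + r < n) :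
    tT d n u j * gProd d n u k r = gProd d n u k r * tT d n u (j + 1) := by
  induction r with
  | zero => omega
  | succ r ih =>
    obtain h | rfl : j < k + r ∨ j = k + r := by omega
    · rw [gProd, ← mul_assoc, (tT_gT_comm (by omega) (by omega)).eq, mul_assoc, ih h (by omega),
        mul_assoc]
    · rw [gProd, ← mul_assoc, tT_mul_gT_left (by omega), mul_assoc,
        (tT_commute_gProd_of_lt (by omega)).eq, mul_assoc]

section RowEvaluation

variable (d n u) in
/-- The embedding of `Y_{d,n}(u)` into its group algebra over `ℤ/dℤ`. -/
noncomputable abbrev ofYH : YH d n u →ₐ[ℂ] AddMonoidAlgebra (YH d n u) (ZMod d) :=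
  AddMonoidAlgebra.singleZeroAlgHom

variable (d n u) in
/-- The generator of `ℤ/dℤ` in the group algebra over `Y_{d,n}(u)`. -/
noncomputable def tau : AddMonoidAlgebra (YH d n u) (ZMod d) := AddMonoidAlgebra.single 1 1

theorem tau_commute (b : AddMonoidAlgebra (YH d n u) (ZMod d)) : Commute (tau d n u) b :=
  AddMonoidAlgebra.single_commute (fun _ => add_comm _ _) (fun _ => Commute.one_left _) b

theorem tau_pow : tau d n u ^ d = 1 := by
  rw [tau, AddMonoidAlgebra.single_pow]
  simp [AddMonoidAlgebra.one_def]

variable (d n u) in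
/-- The right action of `Y_{d,n+1}(u)` on rows over the group algebra. -/
noncomputable def rowAct (y : YH d (n + 1) u) :
    Module.End ℂ (Fin (n + 1) → AddMonoidAlgebra (YH d n u) (ZMod d)) :=
  (rowHom (B := AddMonoidAlgebra (YH d n u) (ZMod d)) (ofYH d n u) (τ := tau d n u)
    tau_commute tau_pow y).unop

theorem rowAct_mul (a b : YH d (n + 1) u)
    (f : Fin (n + 1) → AddMonoidAlgebra (YH d n u) (ZMod d)) :
    rowAct d n u (a * b) f = rowAct d n u b (rowAct d n u a f) := by
  simp [rowAct]

theorem rowAct_add (a b : YH d (n + 1) u) :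
    rowAct d n u (a + b) = rowAct d n u a + rowAct d n u b := by
  simp [rowAct]

theorem rowAct_algebraMap (r : ℂ) (f : Fin (n + 1) → AddMonoidAlgebra (YH d n u) (ZMod d)) :
    rowAct d n u (algebraMap ℂ _ r) f = r • f := by
  simp only [rowAct, AlgHom.commutes, MulOpposite.algebraMap_apply, MulOpposite.unop_op,
    Module.algebraMap_end_apply]

theorem rowAct_gT {i : ℕ} (h : i + 1 < n + 1) :
    rowAct d n u (gT d (n + 1) u i) = rowG (ofYH d n u) (tau d n u) i h := by
  rw [rowAct, rowHom_gT _ _ h]; rfl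

theorem rowAct_tT {j : ℕ} (h : j < n + 1) :
    rowAct d n u (tT d (n + 1) u j) = rowT (ofYH d n u) (tau d n u) j := by
  rw [rowAct, rowHom_tT _ _ h]; rfl

/-- The last entry is the coefficient of w_n = 1, and no generator coming from Y_{d,n} mixes it with
another entry. -/
theorem rowAct_incl_last (b : YH d n u)
    (f : Fin (n + 1) → AddMonoidAlgebra (YH d n u) (ZMod d)) :
    rowAct d n u (incl d n u b) f (Fin.last n) = f (Fin.last n) * ofYH d n u b := by
  induction b using YH_induction generalizing f with
  | halg r =>
    rw [AlgHom.commutes, rowAct_algebraMap, AlgHom.commutes, ← Algebra.commutes,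
      ← Algebra.smul_def, Pi.smul_apply]
  | hg i h => rw [incl_gT h, rowAct_gT (by omega)]; exact rowG_gt _ _ _ h
  | ht j h =>
    rw [incl_tT h, rowAct_tT (by omega), rowT_apply]
    exact congrArg _ (diagT_gt _ h)
  | hadd a b ha hb =>
    rw [map_add, rowAct_add, LinearMap.add_apply, Pi.add_apply, ha, hb, map_add, mul_add]
  | hmul a b ha hb => rw [map_mul, rowAct_mul, hb, ha, mul_assoc, map_mul]

theorem single_last_apply {B : Type*} [Zero B] (b : B) {k : ℕ} (hk : k < n + 1) (h : k ≠ n) :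
    (Pi.single (Fin.last n) b : Fin (n + 1) → B) ⟨k, hk⟩ = 0 :=
  Pi.single_eq_of_ne (fun h' => h (congrArg Fin.val h')) _

theorem single_last_self {B : Type*} [Zero B] (b : B) (hk : n < n + 1) :
    (Pi.single (Fin.last n) b : Fin (n + 1) → B) ⟨n, hk⟩ = b :=
  Pi.single_eq_same (M := fun _ => B) (Fin.last n) b

theorem rowAct_incl_single (a : YH d n u) (b : AddMonoidAlgebra (YH d n u) (ZMod d)) :
    rowAct d n u (incl d n u a) (Pi.single (Fin.last n) b)
      = Pi.single (Fin.last n) (b * ofYH d n u a) := by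
  refine funext fun ⟨l, hl⟩ => ?_
  by_cases h : l = n
  · subst h
    exact (rowAct_incl_last a _).trans (by rw [Pi.single_eq_same, single_last_self])
  rw [single_last_apply _ _ h]
  -- Generalised to every row supported at the last entry, so that the product case can be iterated.
  suffices ∀ f : Fin (n + 1) → AddMonoidAlgebra (YH d n u) (ZMod d),
      (∀ k hk, k ≠ n → f ⟨k, hk⟩ = 0) → ∀ k hk, k ≠ n → rowAct d n u (incl d n u a) f ⟨k, hk⟩ = 0 from
    this _ (fun k hk h => single_last_apply _ _ h) _ _ h
  clear h hl l
  induction a using YH_induction with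
  | halg r =>
    intro f hf k hk h
    rw [AlgHom.commutes, rowAct_algebraMap, Pi.smul_apply, hf _ _ h, smul_zero]
  | hg i h =>
    intro f hf l hl hln
    rw [incl_gT h, rowAct_gT (by omega)]
    obtain h | h | h | h : l < i ∨ l = i ∨ l = i + 1 ∨ i + 1 < l := by omega
    · rw [rowG_lt _ _ _ h, hf _ _ hln, zero_mul]
    · subst h
      rw [rowG_self, hf _ _ hln, hf _ _ (by omega), zero_mul, smul_zero, add_zero]
    · subst h
      rw [rowG_succ, hf _ _ (by omega), zero_mul, smul_zero, add_zero]
    · rw [rowG_gt _ _ _ h, hf _ _ hln, zero_mul]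
  | ht j h =>
    intro f hf l hl hln
    rw [incl_tT h, rowAct_tT (by omega), rowT_apply, hf _ _ hln, zero_mul]
  | hadd a b ha hb =>
    intro f hf l hl hln
    rw [map_add, rowAct_add, LinearMap.add_apply, Pi.add_apply, ha f hf _ _ hln, hb f hf _ _ hln,
      add_zero]
  | hmul a b ha hb =>
    intro f hf l hl hln
    rw [map_mul, rowAct_mul]
    exact hb _ (ha f hf) _ _ hln

theorem rowAct_tT_pow_single (m : ℕ) (b : AddMonoidAlgebra (YH d n u) (ZMod d)) :
    rowAct d n u (tT d (n + 1) u n ^ m) (Pi.single (Fin.last n) b)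
      = Pi.single (Fin.last n) (b * tau d n u ^ m) := by
  induction m with
  | zero => simpa using rowAct_algebraMap (d := d) (n := n) (u := u) 1 (Pi.single (Fin.last n) b)
  | succ m ih =>
    rw [pow_succ, rowAct_mul, ih, rowAct_tT (by omega)]
    refine funext fun ⟨l, hl⟩ => ?_
    by_cases h : l = n
    · subst h
      rw [rowT_apply, diagT_self, single_last_self, single_last_self, pow_succ, mul_assoc]
    · rw [rowT_apply, single_last_apply _ _ h, single_last_apply _ _ h, zero_mul]

variable [NeZero d]

variable (d n u) in
/-- Evaluation of the entry with index `k` of a row, `∑ a_m τ^m ↦ ∑ a_m g_{n-1} ⋯ g_k t_k^m`. -/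
noncomputable def evalEntry (k : ℕ) : AddMonoidAlgebra (YH d n u) (ZMod d) →ₗ[ℂ] YH d n u :=
  evalCoeff (gProd d n u k (n - 1 - k)) (tT d n u k)

/-- The word used by `evalEntry` is g_{n-2} ⋯ g_k, that is w_k without its first letter g_{n-1},
which the Markov rule replaces by z. A coefficient c on the left of this word becomes c' on its
right. -/
theorem evalEntry_mul {k : ℕ} {c c' : YH d n u}
    (h : c * gProd d n u k (n - 1 - k) = gProd d n u k (n - 1 - k) * c')
    (hs : Commute c' (tT d n u k)) (b : AddMonoidAlgebra (YH d n u) (ZMod d)) :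
    evalEntry d n u k (b * ofYH d n u c) = evalEntry d n u k b * c' :=
  evalCoeff_mul_single_zero h hs b

theorem evalEntry_mul_tau (k : ℕ) (b : AddMonoidAlgebra (YH d n u) (ZMod d)) :
    evalEntry d n u k (b * tau d n u) = evalEntry d n u k b * tT d n u k :=
  evalCoeff_mul_single_one (tT_pow k) b

theorem evalEntry_succ_mul_gT {k : ℕ} (hk : k + 1 < n)
    (b : AddMonoidAlgebra (YH d n u) (ZMod d)) :
    evalEntry d n u (k + 1) b * gT d n u k = evalEntry d n u k b := by
  induction b using AddMonoidAlgebra.induction_linear with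
  | zero => simp
  | add b b' hb hb' => rw [map_add, add_mul, hb, hb', map_add]
  | single m a =>
    rw [evalEntry, evalEntry, evalCoeff_single, evalCoeff_single, mul_assoc, mul_assoc,
      ← gT_mul_tT_pow hk, ← mul_assoc (gProd _ _ _ _ _), show n - 1 - k = n - 1 - (k + 1) + 1 by omega,
      gProd_succ]

theorem evalEntry_mul_avg {j : ℕ} (b : AddMonoidAlgebra (YH d n u) (ZMod d)) :
    evalEntry d n u (j + 1) (b * avg d (ofYH d n u (tT d n u j)) (tau d n u))
      = evalEntry d n u (j + 1) b * eT d n u j :=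
  map_mul_avg _ (fun b => evalEntry_mul (tT_commute_gProd _ (by omega)).eq (tT_comm _ _) b)
    (fun b => evalEntry_mul_tau _ b) b

variable (d n u) in
/-- The map `∑ f_k b_k ↦ ∑ f_k(t_k) g_{n-1} ⋯ g_k` on the first `n` entries of a row. -/
noncomputable def evalRow :
    (Fin (n + 1) → AddMonoidAlgebra (YH d n u) (ZMod d)) →ₗ[ℂ] YH d n u :=
  ∑ k : Fin n, evalEntry d n u k ∘ₗ LinearMap.proj k.castSucc

theorem evalRow_apply (f : Fin (n + 1) → AddMonoidAlgebra (YH d n u) (ZMod d)) :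
    evalRow d n u f = ∑ k : Fin n, evalEntry d n u k (f k.castSucc) := by
  simp [evalRow]

theorem evalRow_rowT {j : ℕ} (hj : j < n)
    (f : Fin (n + 1) → AddMonoidAlgebra (YH d n u) (ZMod d)) :
    evalRow d n u (rowT (ofYH d n u) (tau d n u) j f) = evalRow d n u f * tT d n u j := by
  rw [evalRow_apply, evalRow_apply, Finset.sum_mul]
  refine Finset.sum_congr rfl fun ⟨k, hk⟩ _ => ?_
  simp only [Fin.castSucc_mk, rowT_apply]
  obtain h | rfl | h := lt_trichotomy k j
  · obtain ⟨j, rfl⟩ : ∃ i, j = i + 1 := ⟨j - 1, by omega⟩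
    rw [diagT_lt _ h, Nat.add_sub_cancel,
      evalEntry_mul (tT_mul_gProd (by omega) (by omega) (by omega)) (tT_comm _ _)]
  · rw [diagT_self, evalEntry_mul_tau]
  · rw [diagT_gt _ h, evalEntry_mul (tT_commute_gProd _ h).eq (tT_comm _ _)]

/-- Entries other than j and j+1 agree one by one. Those two agree only in sum, after g_j² is
expanded by the quadratic relation. -/
theorem evalRow_rowG {j : ℕ} (hj : j + 1 < n)
    (f : Fin (n + 1) → AddMonoidAlgebra (YH d n u) (ZMod d)) :
    evalRow d n u (rowG (ofYH d n u) (tau d n u) j (by omega) f)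
      = evalRow d n u f * gT d n u j := by
  rw [evalRow_apply, evalRow_apply, Finset.sum_mul, ← sub_eq_zero, ← Finset.sum_sub_distrib]
  rw [Finset.sum_eq_add (⟨j, by omega⟩ : Fin n) ⟨j + 1, hj⟩ (by simp) ?_ (by simp) (by simp)]
  · simp only [Fin.castSucc_mk, rowG_self, rowG_succ, map_add, map_smul, evalEntry_mul_avg]
    simp only [← evalEntry_succ_mul_gT hj, evalEntry_mul_avg]
    rw [mul_assoc _ (gT d n u j) (gT d n u j), gT_sq hj]
    simp only [mul_add, mul_one, mul_smul_comm, ← mul_assoc]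
    abel
  · rintro ⟨k, hk⟩ - ⟨h1, h2⟩
    have h1 : k ≠ j := fun h => h1 (Fin.ext h)
    have h2 : k ≠ j + 1 := fun h => h2 (Fin.ext h)
    simp only [Fin.castSucc_mk]
    obtain h | h : k < j ∨ j + 1 < k := by omega
    · obtain ⟨j, rfl⟩ : ∃ i, j = i + 1 := ⟨j - 1, by omega⟩
      rw [rowG_lt _ _ _ h, Nat.add_sub_cancel, evalEntry_mul
        (gT_mul_gProd (by omega) (by omega) (by omega)) (tT_gT_comm (by omega) (by omega)).symm,
        sub_self]
    · rw [rowG_gt _ _ _ h, evalEntry_mul (gT_commute_gProd _ h).eq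
        (tT_gT_comm (by omega) (by omega)).symm, sub_self]

theorem evalRow_rowAct_incl (b : YH d n u)
    (f : Fin (n + 1) → AddMonoidAlgebra (YH d n u) (ZMod d)) :
    evalRow d n u (rowAct d n u (incl d n u b) f) = evalRow d n u f * b := by
  induction b using YH_induction generalizing f with
  | halg r =>
    rw [AlgHom.commutes, rowAct_algebraMap, map_smul, ← Algebra.commutes, Algebra.smul_def]
  | hg i h => rw [incl_gT h, rowAct_gT (by omega), evalRow_rowG h]
  | ht j h => rw [incl_tT h, rowAct_tT (by omega), evalRow_rowT h]
  | hadd a b ha hb => rw [map_add, rowAct_add, LinearMap.add_apply, map_add, ha, hb, mul_add]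
  | hmul a b ha hb => rw [map_mul, rowAct_mul, hb, ha, mul_assoc]

theorem evalRow_single_last (b : AddMonoidAlgebra (YH d n u) (ZMod d)) :
    evalRow d n u (Pi.single (Fin.last n) b) = 0 := by
  rw [evalRow_apply]
  refine Finset.sum_eq_zero fun ⟨k, hk⟩ _ => ?_
  rw [Fin.castSucc_mk, single_last_apply _ _ hk.ne, map_zero]

variable {R : Type*} [CommRing R] [Algebra ℂ R] (z : R) (x : ZMod d → R) (τ : YH d n u →ₗ[ℂ] R)

/-- The extension of a functional on `Y_{d,n}(u)` to `Y_{d,n+1}(u)` with parameters `z`, `x`. -/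
noncomputable def extend : YH d (n + 1) u →ₗ[ℂ] R where
  toFun y :=
    sumCoeff (fun m => LinearMap.mulLeft ℂ (x m) ∘ₗ τ)
      (rowAct d n u y (Pi.single (Fin.last n) 1) (Fin.last n))
    + z * τ (evalRow d n u (rowAct d n u y (Pi.single (Fin.last n) 1)))
  map_add' a b := by
    simp only [rowAct_add, LinearMap.add_apply, Pi.add_apply, map_add, mul_add]
    abel
  map_smul' r a := by
    have h : rowAct d n u (r • a) (Pi.single (Fin.last n) 1)
        = r • rowAct d n u a (Pi.single (Fin.last n) 1) := by
      rw [Algebra.smul_def, Algebra.commutes, rowAct_mul, rowAct_algebraMap]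
    simp only [h, Pi.smul_apply, map_smul, smul_add, mul_smul_comm, RingHom.id_apply]

/-- The row of 1 has its only nonzero entry at the end; a t_n^m turns that entry into a τ^m. -/
theorem extend_mul_tT_pow (a : YH d n u) (m : ℕ) :
    extend z x τ (incl d n u a * tT d (n + 1) u n ^ m) = x m * τ a := by
  have h : rowAct d n u (incl d n u a * tT d (n + 1) u n ^ m) (Pi.single (Fin.last n) 1)
      = Pi.single (Fin.last n) (AddMonoidAlgebra.single (m : ZMod d) a) := by
    rw [rowAct_mul, rowAct_incl_single, rowAct_tT_pow_single, one_mul, tau,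
      AddMonoidAlgebra.single_pow, AddMonoidAlgebra.singleZeroAlgHom_apply,
      AddMonoidAlgebra.single_mul_single]
    simp
  change sumCoeff _ (rowAct d n u _ _ _) + z * τ (evalRow d n u (rowAct d n u _ _)) = _
  rw [h, evalRow_single_last, Pi.single_eq_same, sumCoeff_single, map_zero, mul_zero, add_zero]
  rfl

/-- The letter g_{n-1} moves a from the last entry to the one before, where the remaining word is
empty and evaluation returns a. Right Y_{d,n}-linearity of `evalRow` then supplies b. -/
theorem extend_mul_gT_mul {i : ℕ} (hi : i + 1 = n) (a b : YH d n u) :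
    extend z x τ (incl d n u a * gT d (n + 1) u i * incl d n u b) = z * τ (a * b) := by
  subst hi
  set f := rowG (ofYH d (i + 1) u) (tau d (i + 1) u) i (by omega)
    (Pi.single (Fin.last (i + 1)) (ofYH d (i + 1) u a)) with hf
  have h : rowAct d (i + 1) u (incl d (i + 1) u a * gT d (i + 1 + 1) u i * incl d (i + 1) u b)
      (Pi.single (Fin.last (i + 1)) 1) = rowAct d (i + 1) u (incl d (i + 1) u b) f := by
    rw [rowAct_mul, rowAct_mul, rowAct_incl_single, one_mul, rowAct_gT (by omega)]
  have h0 : f (Fin.last (i + 1)) = 0 := by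
    change rowG _ _ _ _ _ ⟨i + 1, _⟩ = 0
    rw [rowG_succ, single_last_apply _ _ (by omega), zero_mul, smul_zero, add_zero]
  have h1 : evalRow d (i + 1) u f = a := by
    rw [evalRow_apply, Finset.sum_eq_single ⟨i, by omega⟩]
    · have h2 : f ⟨i, by omega⟩ = ofYH d (i + 1) u a := by
        rw [hf, rowG_self, single_last_apply _ _ (by omega), zero_mul, smul_zero, zero_add]
        exact Pi.single_eq_same _ _
      rw [Fin.castSucc_mk, h2, AddMonoidAlgebra.singleZeroAlgHom_apply, evalEntry,
        evalCoeff_single]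
      simp [gProd]
    · rintro ⟨k, hk⟩ - hki
      have hki : k ≠ i := fun h => hki (Fin.ext h)
      rw [Fin.castSucc_mk, hf, rowG_lt _ _ _ (by omega), single_last_apply _ _ (by omega),
        zero_mul, map_zero]
    · simp
  change sumCoeff _ (rowAct d (i + 1) u _ _ _)
    + z * τ (evalRow d (i + 1) u (rowAct d (i + 1) u _ _)) = _
  rw [h, rowAct_incl_last, h0, zero_mul, map_zero, zero_add, evalRow_rowAct_incl, h1]

end RowEvaluation

end YokonumaHecke

/-! ### Traciality of iterated Markov extensions -/

namespace YokonumaHecke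

variable {d : ℕ} {u : ℂ} {R : Type*} [CommRing R] [Algebra ℂ R]

/-- `τ'` extends the functional `τ` from `Y_{d,n}(u)` to `Y_{d,n+1}(u)` by the Markov rules. -/
structure IsMarkovExtension {n : ℕ} (z : R) (x : ZMod d → R) (τ : YH d n u →ₗ[ℂ] R)
    (τ' : YH d (n + 1) u →ₗ[ℂ] R) : Prop where
  mul_tT_pow : ∀ (a : YH d n u) (m : ℕ), τ' (incl d n u a * tT d (n + 1) u n ^ m) = x m * τ a
  mul_gT_mul : ∀ (i : ℕ), i + 1 = n → ∀ a b : YH d n u,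
    τ' (incl d n u a * gT d (n + 1) u i * incl d n u b) = z * τ (a * b)

/-- The trace property. -/
def IsTracial {A : Type*} [Ring A] [Algebra ℂ A] (τ : A →ₗ[ℂ] R) : Prop :=
  ∀ a b, τ (a * b) = τ (b * a)

section BraidWords

variable {M : Type*} [Semigroup M] {g k c c' : M}

theorem mul_braid_mul_sq (h : k * g * k = g * k * g)
    (hc : c * g = g * c) (hc' : c' * g = g * c') (a : M) :
    a * g * (c * k * c') * (g * g) = a * c * k * k * g * (k * c') := by
  rw [← mul_assoc, mul_braid_mul h hc hc']
  calc a * c * k * g * (k * c') * g = a * c * k * g * k * (c' * g) := by simp only [mul_assoc]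
    _ = a * c * k * (g * k * g) * c' := by rw [hc']; simp only [mul_assoc]
    _ = _ := by rw [← h]; simp only [mul_assoc]

theorem mul_sq_braid_mul (h : k * g * k = g * k * g)
    (hc : c * g = g * c) (hc' : c' * g = g * c') (a : M) :
    a * (g * g) * (c * k * c') * g = a * c * k * g * (k * k * c') := by
  rw [← mul_assoc a, mul_braid_mul h hc hc']
  calc a * g * c * k * g * (k * c') = a * (g * c) * k * g * (k * c') := by simp only [mul_assoc]
    _ = a * c * (g * k * g) * k * c' := by rw [← hc]; simp only [mul_assoc]
    _ = _ := by rw [← h]; simp only [mul_assoc]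

end BraidWords

section

variable {n : ℕ} {z : R} {x : ZMod d → R}

theorem IsMarkovExtension.mul_incl_comm {τ : YH d n u →ₗ[ℂ] R} {τ' : YH d (n + 1) u →ₗ[ℂ] R}
    (h : IsMarkovExtension z x τ τ') (ht : IsTracial τ) (y : YH d (n + 1) u) (c : YH d n u) :
    τ' (y * incl d n u c) = τ' (incl d n u c * y) := by
  induction y using YH_succ_induction with
  | hadd y y' hy hy' => rw [add_mul, mul_add, map_add, map_add, hy, hy']
  | ht a m =>
    rw [mul_assoc, ← ((incl_commute_tT c).pow_right m).eq, ← mul_assoc, ← mul_assoc, ← map_mul,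
      ← map_mul, h.mul_tT_pow, h.mul_tT_pow, ht]
  | hg i a b hi =>
    rw [mul_assoc, ← map_mul, ← mul_assoc, ← mul_assoc, ← map_mul, h.mul_gT_mul _ hi,
      h.mul_gT_mul _ hi, ← mul_assoc, ht, mul_assoc]

theorem IsMarkovExtension.mul_tT_comm {τ : YH d n u →ₗ[ℂ] R} {τ' : YH d (n + 1) u →ₗ[ℂ] R}
    (h : IsMarkovExtension z x τ τ') (y : YH d (n + 1) u) :
    τ' (y * tT d (n + 1) u n) = τ' (tT d (n + 1) u n * y) := by
  induction y using YH_succ_induction with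
  | hadd y y' hy hy' => rw [add_mul, mul_add, map_add, map_add, hy, hy']
  | ht a m =>
    rw [← mul_assoc, ← (incl_commute_tT a).eq, mul_assoc, mul_assoc, ← pow_succ, ← pow_succ']
  | hg i a b hi =>
    subst hi
    rw [mul_assoc, (incl_commute_tT b).eq, ← mul_assoc, mul_assoc (incl d _ u a),
      ← tT_mul_gT_left (by omega), ← mul_assoc, ← mul_assoc, ← mul_assoc,
      ← (incl_commute_tT a).eq, mul_assoc (incl d _ u a) (tT d _ u (i + 1)),
      tT_mul_gT_right (by omega), ← incl_tT (by omega : i < i + 1), ← map_mul,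
      h.mul_gT_mul _ rfl, ← mul_assoc, mul_assoc _ _ (incl d _ u b), ← map_mul,
      h.mul_gT_mul _ rfl, mul_assoc]

end

section

variable {n : ℕ} {z : R} {x : ZMod d → R} {τ₀ : YH d n u →ₗ[ℂ] R} {τ₁ : YH d (n + 1) u →ₗ[ℂ] R}
  {τ₂ : YH d (n + 1 + 1) u →ₗ[ℂ] R}

/-- The form `(a, b) ↦ τ(a g_n b g_n)` on `Y_{d,n}(u)`. -/
noncomputable def gForm (τ₂ : YH d (n + 1 + 1) u →ₗ[ℂ] R) (a b : YH d (n + 1) u) : R :=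
  τ₂ (incl d _ u a * gT d _ u n * incl d _ u b * gT d _ u n)

theorem gForm_add_left (a a' b : YH d (n + 1) u) :
    gForm τ₂ (a + a') b = gForm τ₂ a b + gForm τ₂ a' b := by
  simp [gForm, add_mul]

theorem gForm_add_right (a b b' : YH d (n + 1) u) :
    gForm τ₂ a (b + b') = gForm τ₂ a b + gForm τ₂ a b' := by
  simp [gForm, add_mul, mul_add]

/-- Elements of Y_{d,n} commute with g_n, so the form is balanced over Y_{d,n}. -/
theorem gForm_incl_mul_right (a b : YH d (n + 1) u) (c : YH d n u) :
    gForm τ₂ a (incl d n u c * b) = gForm τ₂ (a * incl d n u c) b := by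
  have h := (incl_incl_commute_gT c).eq
  simp only [gForm, map_mul, mul_assoc]
  rw [← mul_assoc (gT d _ u n) (incl d _ u (incl d _ u c)), ← h, mul_assoc]

variable (h2 : IsMarkovExtension z x τ₁ τ₂) (h1 : IsMarkovExtension z x τ₀ τ₁)
  (t1 : IsTracial τ₁)

include h2 t1 in
theorem gForm_mul_incl_right (a b : YH d (n + 1) u) (c : YH d n u) :
    gForm τ₂ a (b * incl d n u c) = gForm τ₂ (incl d n u c * a) b := by
  have h := (incl_incl_commute_gT c).eq
  simp only [gForm, map_mul, mul_assoc]
  rw [h]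
  simp only [← mul_assoc]
  rw [h2.mul_incl_comm t1]
  simp only [mul_assoc]

include h2 t1 in
-- Moving factors from Y_{d,n} across the form reduces b to a power of the last framing or to the
-- last braid generator; these two cases are the hypotheses.
theorem gForm_comm (a b : YH d (n + 1) u)
    (hT : ∀ a j, gForm τ₂ a (tT d (n + 1) u n ^ j) = gForm τ₂ (tT d (n + 1) u n ^ j) a)
    (hG : ∀ i, i + 1 = n → ∀ a, gForm τ₂ a (gT d (n + 1) u i) = gForm τ₂ (gT d (n + 1) u i) a) :
    gForm τ₂ a b = gForm τ₂ b a := by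
  induction b using YH_succ_induction with
  | hadd b b' hb hb' => rw [gForm_add_left, gForm_add_right, hb, hb']
  | ht c j =>
    rw [gForm_incl_mul_right, hT, gForm_mul_incl_right h2 t1]
  | hg i c c' hi =>
    rw [gForm_mul_incl_right h2 t1, gForm_incl_mul_right, hG i hi,
      gForm_mul_incl_right h2 t1, gForm_incl_mul_right]

end

theorem IsMarkovExtension.mul_gT_sq [NeZero d] {n : ℕ} {z : R} {x : ZMod d → R}
    {τ : YH d (n + 1) u →ₗ[ℂ] R} {τ' : YH d (n + 1 + 1) u →ₗ[ℂ] R}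
    (h : IsMarkovExtension z x τ τ') (a : YH d (n + 1) u) (j : ℕ) :
    τ' (incl d _ u a * tT d _ u (n + 1) ^ j * (gT d _ u n * gT d _ u n))
      = x j * τ a
        + (u - 1) • ((1 / (d : ℂ)) • ∑ s ∈ Finset.range d,
            x ((j + (d - s) : ℕ)) * τ (a * tT d _ u n ^ s))
        + (u - 1) • (z * τ (a * tT d _ u n ^ j)) := by
  have he : incl d _ u a * tT d _ u (n + 1) ^ j * eT d _ u n
      = (1 / (d : ℂ)) • ∑ s ∈ Finset.range d,
        incl d _ u (a * tT d _ u n ^ s) * tT d _ u (n + 1) ^ (j + (d - s)) := by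
    rw [eT, avg, mul_smul_comm, Finset.mul_sum]
    congr 1
    refine Finset.sum_congr rfl fun s _ => ?_
    rw [map_mul, map_pow, incl_tT (by omega), pow_add, ← mul_assoc, ← mul_assoc,
      mul_assoc (incl d _ u a), ((tT_comm (n + 1) n).pow_pow j s).eq, ← mul_assoc]
  have hd : (d : ℂ) ≠ 0 := Nat.cast_ne_zero.mpr (NeZero.ne d)
  rw [gT_sq (by omega), mul_add, mul_add, mul_one, mul_smul_comm, mul_smul_comm, ← mul_assoc, he]
  simp only [map_add, map_smul, map_sum, h.mul_tT_pow, smul_mul_assoc, Finset.sum_mul]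
  congr 2
  -- All d summands of the e_n g_n term have the same trace: once the framings are gathered, t_n^s
  -- t_n^{j+d-s} = t_n^j. This cancels the factor 1/d.
  have hs : ∀ s ∈ Finset.range d, τ' (incl d _ u (a * tT d _ u n ^ s)
      * tT d _ u (n + 1) ^ (j + (d - s)) * gT d _ u n) = z * τ (a * tT d _ u n ^ j) := by
    intro s hs
    have hs := Finset.mem_range.mp hs
    have h3 := h.mul_gT_mul n rfl (a * tT d _ u n ^ s) (tT d _ u n ^ (j + (d - s)))
    rw [map_pow, incl_tT (by omega), mul_assoc, gT_mul_tT_pow (by omega), ← mul_assoc] at h3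
    rw [h3, mul_assoc, ← pow_add, show s + (j + (d - s)) = j + d by omega, pow_add, tT_pow, mul_one]
  rw [Finset.sum_congr rfl hs, Finset.sum_const, Finset.card_range, ← Nat.cast_smul_eq_nsmul ℂ,
    smul_smul, one_div_mul_cancel hd, one_smul]

section

variable {n : ℕ} {z : R} {x : ZMod d → R} {τ₀ : YH d (n + 1) u →ₗ[ℂ] R}
  {τ₁ : YH d (n + 1 + 1) u →ₗ[ℂ] R} {τ₂ : YH d (n + 1 + 1 + 1) u →ₗ[ℂ] R}
  (h2 : IsMarkovExtension z x τ₁ τ₂) (h1 : IsMarkovExtension z x τ₀ τ₁)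
  (t1 : IsTracial τ₁) (t0 : IsTracial τ₀)

theorem gForm_tT_pow {k : ℕ} (τ : YH d (k + 1 + 1) u →ₗ[ℂ] R) (a : YH d (k + 1) u) (j : ℕ) :
    gForm τ a (tT d _ u k ^ j)
      = τ (incl d _ u a * tT d _ u (k + 1) ^ j * (gT d _ u k * gT d _ u k)) := by
  rw [gForm, map_pow, incl_tT (by omega), mul_assoc (incl _ _ _ _), gT_mul_tT_pow (by omega)]
  simp only [mul_assoc]

include h2 in
-- The braid relation leaves one letter g_{n+1}, and the Markov rule removes it: the form descends
-- to τ₁.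
theorem gForm_mul_gT_mul (a : YH d (n + 1 + 1) u) (c c' : YH d (n + 1) u) :
    gForm τ₂ a (incl d _ u c * gT d _ u n * incl d _ u c')
      = z * τ₁ (a * incl d _ u c * gT d _ u n * (gT d _ u n * incl d _ u c')) := by
  have h3 := gT_braid (d := d) (u := u) (by omega : n + 2 < n + 1 + 1 + 1)
  rw [← h2.mul_gT_mul _ rfl]
  simp only [gForm, map_mul, incl_gT (by omega : n + 1 < n + 1 + 1)]
  exact congrArg τ₂ (mul_braid_mul h3 (incl_incl_commute_gT c).eq (incl_incl_commute_gT c').eq _)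

include h2 h1 t1 t0 in
-- Both sides expand by `mul_gT_sq`, one for τ₂ and the other for τ₁; the former has a factor z
-- inside each term, the latter in front.
theorem gForm_gT_mul_tT_pow [NeZero d] (C : YH d (n + 1) u) (j : ℕ) :
    gForm τ₂ (gT d _ u n * incl d _ u C) (tT d _ u (n + 1) ^ j)
      = gForm τ₂ (tT d _ u (n + 1) ^ j) (gT d _ u n * incl d _ u C) := by
  have e2 : gForm τ₂ (tT d _ u (n + 1) ^ j) (gT d _ u n * incl d _ u C)
      = z * τ₁ (incl d _ u C * tT d _ u (n + 1) ^ j * (gT d _ u n * gT d _ u n)) := by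
    have h3 := gForm_mul_gT_mul h2 (tT d _ u (n + 1) ^ j) 1 C
    rw [map_one, one_mul, mul_one] at h3
    rw [h3, ← mul_assoc, t1, mul_assoc _ (gT d _ u n), ← mul_assoc (incl _ _ _ _)]
  have e3 : ∀ s, τ₁ (gT d _ u n * incl d _ u C * tT d _ u (n + 1) ^ s)
      = z * τ₀ (C * tT d _ u n ^ s) := fun s => by
    rw [mul_assoc, ((incl_commute_tT C).pow_right s).eq, ← mul_assoc, gT_mul_tT_succ_pow (by omega),
      ← incl_tT (by omega : n < n + 1), ← map_pow, h1.mul_gT_mul _ rfl, t0]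
  have e4 : τ₁ (gT d _ u n * incl d _ u C) = z * τ₀ C := by simpa using e3 0
  rw [gForm_tT_pow, e2, h2.mul_gT_sq, h1.mul_gT_sq, e4]
  simp only [e3, mul_add, mul_smul_comm, Finset.mul_sum, mul_left_comm z]

include h1 t1 in
-- This is the symmetry of the form at the pair (c g c', g), one level down. If c' ends in a framing
-- power, both sides reduce to g³ and cyclicity carries the framing around. If c' contains a braid
-- letter, braid relations bring both sides to the same value of τ₀.
theorem mul_gT_mul_gT_sq (c c' : YH d (n + 1) u) :
    τ₁ (incl d _ u c * gT d _ u n * incl d _ u c' * (gT d _ u n * gT d _ u n))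
      = τ₁ (incl d _ u c * (gT d _ u n * gT d _ u n) * incl d _ u c' * gT d _ u n) := by
  induction c' using YH_succ_induction with
  | hadd b b' hb hb' => simp only [map_add, mul_add, add_mul, hb, hb']
  | ht b j =>
    have h := (incl_incl_commute_gT b).eq
    have h3 := gT_mul_tT_pow (d := d) (u := u) (by omega : n + 1 < n + 1 + 1) j
    have h4 := gT_mul_tT_succ_pow (d := d) (u := u) (by omega : n + 1 < n + 1 + 1) j
    have e1 : incl d _ u c * gT d _ u n * incl d _ u (incl d _ u b * tT d _ u n ^ j)
          * (gT d _ u n * gT d _ u n)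
        = incl d _ u (c * incl d _ u b) * tT d _ u (n + 1) ^ j
          * (gT d _ u n * gT d _ u n * gT d _ u n) := by
      rw [map_mul, map_mul, map_pow, incl_tT (by omega), mul_assoc (incl d _ u c), ← mul_assoc (gT d _ u n),
        ← h, mul_assoc _ (gT d _ u n), h3]
      simp only [mul_assoc]
    have e2 : incl d _ u c * (gT d _ u n * gT d _ u n) * incl d _ u (incl d _ u b * tT d _ u n ^ j)
          * gT d _ u n
        = incl d _ u (c * incl d _ u b) * (gT d _ u n * gT d _ u n * gT d _ u n)
          * tT d _ u (n + 1) ^ j := by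
      rw [map_mul, map_mul, map_pow, incl_tT (by omega), mul_assoc _ _ (gT d _ u n),
        mul_assoc _ _ (gT d _ u n), ← h4]
      simp only [← mul_assoc]
      rw [mul_assoc _ (gT d _ u n) (incl d _ u (incl d _ u b)), ← h, ← mul_assoc,
        mul_assoc _ (gT d _ u n) (incl d _ u (incl d _ u b)), ← h, ← mul_assoc]
    rw [e1, e2, t1 _ (tT d _ u (n + 1) ^ j), ← mul_assoc (tT d _ u (n + 1) ^ j),
      ← ((incl_commute_tT _).pow_right j).eq]
  | hg i b b' hi =>
    subst hi
    have h3 := gT_braid (d := d) (u := u) (by omega : i + 2 < i + 1 + 1 + 1)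
    have h4 := (incl_incl_commute_gT b).eq
    have h5 := (incl_incl_commute_gT b').eq
    have e1 : incl d _ u c * gT d _ u (i + 1) * incl d _ u (incl d _ u b * gT d _ u i * incl d _ u b')
          * (gT d _ u (i + 1) * gT d _ u (i + 1))
        = incl d _ u (c * incl d _ u b * gT d _ u i * gT d _ u i) * gT d _ u (i + 1)
          * incl d _ u (gT d _ u i * incl d _ u b') := by
      simp only [map_mul, incl_gT (by omega : i + 1 < i + 1 + 1)]
      exact mul_braid_mul_sq h3 h4 h5 _
    have e2 : incl d _ u c * (gT d _ u (i + 1) * gT d _ u (i + 1))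
          * incl d _ u (incl d _ u b * gT d _ u i * incl d _ u b') * gT d _ u (i + 1)
        = incl d _ u (c * incl d _ u b * gT d _ u i) * gT d _ u (i + 1)
          * incl d _ u (gT d _ u i * gT d _ u i * incl d _ u b') := by
      simp only [map_mul, incl_gT (by omega : i + 1 < i + 1 + 1)]
      exact mul_sq_braid_mul h3 h4 h5 _
    rw [e1, e2, h1.mul_gT_mul _ rfl, h1.mul_gT_mul _ rfl]
    simp only [mul_assoc]

/-- Next to e_k the framings t_k^i and t_{k+1}^j merge into t_{k+1}^{i+j}, and the term without e_k
gives x_i x_j; everything is symmetric in i and j. -/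
theorem gForm_tT_pow_tT_pow {k : ℕ} {σ₀ : YH d k u →ₗ[ℂ] R} {σ₁ : YH d (k + 1) u →ₗ[ℂ] R}
    {σ₂ : YH d (k + 1 + 1) u →ₗ[ℂ] R} (h2 : IsMarkovExtension z x σ₁ σ₂)
    (h1 : IsMarkovExtension z x σ₀ σ₁) (c : YH d k u) (i j : ℕ) :
    gForm σ₂ (incl d _ u c * tT d _ u k ^ i) (tT d _ u k ^ j)
      = gForm σ₂ (incl d _ u c * tT d _ u k ^ j) (tT d _ u k ^ i) := by
  have he : ∀ i j : ℕ, incl d _ u (incl d _ u c * tT d _ u k ^ i) * tT d _ u (k + 1) ^ j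
      * eT d _ u k = incl d _ u (incl d _ u c) * (eT d _ u k * tT d _ u (k + 1) ^ (i + j)) := by
    intro i j
    have hc := (commute_avg (d := d) (tT_comm (d := d) (n := k + 1 + 1) (u := u) k (k + 1))
      (Commute.refl _))
    rw [map_mul, map_pow, incl_tT (by omega), pow_add, ← mul_assoc (eT _ _ _ _), eT,
      ← avg_mul_pow (tT_comm _ _) (tT_pow _) (tT_pow _), mul_assoc, mul_assoc,
      ← (hc.pow_right j).eq, ← mul_assoc (_ ^ i), mul_assoc (avg _ _ _),
      ((commute_avg (d := d) (Commute.refl _) (tT_comm (d := d) (n := k + 1 + 1) (u := u)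
        (k + 1) k)).pow_right i).symm.eq, mul_assoc]
  rw [gForm_tT_pow, gForm_tT_pow, gT_sq (by omega)]
  simp only [mul_add, mul_one, mul_smul_comm, ← mul_assoc, he, map_add, map_smul, h2.mul_tT_pow,
    h1.mul_tT_pow]
  rw [add_comm i j, mul_comm (x j)]

include h2 h1 t1 t0 in
theorem gForm_tT_pow_comm [NeZero d] (a : YH d (n + 1 + 1) u) (j : ℕ) :
    gForm τ₂ a (tT d _ u (n + 1) ^ j) = gForm τ₂ (tT d _ u (n + 1) ^ j) a := by
  induction a using YH_succ_induction with
  | hadd b b' hb hb' => rw [gForm_add_left, gForm_add_right, hb, hb']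
  | ht c i =>
    rw [gForm_tT_pow_tT_pow h2 h1, gForm_incl_mul_right, ((incl_commute_tT c).pow_right j).eq]
  | hg i c c' hi =>
    obtain rfl : i = n := by omega
    have h := ((incl_commute_tT c).pow_right j).eq
    rw [mul_assoc, ← gForm_mul_incl_right h2 t1, ← h, gForm_incl_mul_right, gForm_incl_mul_right,
      ← h, ← gForm_mul_incl_right h2 t1, mul_assoc, ← map_mul, gForm_gT_mul_tT_pow h2 h1 t1 t0]

include h2 h1 t1 t0 in
theorem gForm_gT_comm [NeZero d] (a : YH d (n + 1 + 1) u) :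
    gForm τ₂ a (gT d _ u n) = gForm τ₂ (gT d _ u n) a := by
  induction a using YH_succ_induction with
  | hadd b b' hb hb' => rw [gForm_add_left, gForm_add_right, hb, hb']
  | ht c j =>
    rw [← gForm_mul_incl_right h2 t1, ← gForm_tT_pow_comm h2 h1 t1 t0, gForm_incl_mul_right]
  | hg i c c' hi =>
    obtain rfl : i = n := by omega
    have h3 := gForm_mul_gT_mul h2 (incl d _ u c * gT d _ u i * incl d _ u c') 1 1
    simp only [map_one, one_mul, mul_one] at h3
    rw [h3, gForm_mul_gT_mul h2]
    have h4 := mul_gT_mul_gT_sq h1 t1 c c'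
    simp only [mul_assoc] at h4 ⊢
    rw [h4, t1 (gT _ _ _ _)]
    simp only [mul_assoc]

end

/-- A functional is tracial as soon as it is cyclic with respect to the generators. -/
theorem isTracial_of_generators {n : ℕ} {τ : YH d n u →ₗ[ℂ] R}
    (hg : ∀ i, i + 1 < n → ∀ y, τ (y * gT d n u i) = τ (gT d n u i * y))
    (ht : ∀ j, j < n → ∀ y, τ (y * tT d n u j) = τ (tT d n u j * y)) : IsTracial τ := by
  intro y b
  induction b using YH_induction generalizing y with
  | halg r => rw [Algebra.commutes]
  | hg i h => exact hg i h y
  | ht j h => exact ht j h y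
  | hadd a b ha hb => rw [mul_add, add_mul, map_add, map_add, ha, hb]
  | hmul a b ha hb => rw [← mul_assoc, hb, ← mul_assoc, ha, mul_assoc]

section

variable {z : R} {x : ZMod d → R}

theorem IsMarkovExtension.isTracial_of_mul_gT {n : ℕ} {τ : YH d n u →ₗ[ℂ] R}
    {τ' : YH d (n + 1) u →ₗ[ℂ] R} (h : IsMarkovExtension z x τ τ') (ht : IsTracial τ)
    (hg : ∀ i, i + 1 = n → ∀ y, τ' (y * gT d (n + 1) u i) = τ' (gT d (n + 1) u i * y)) :
    IsTracial τ' := by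
  refine isTracial_of_generators (fun i hi y => ?_) (fun j hj y => ?_)
  · obtain hi | hi : i + 1 < n ∨ i + 1 = n := by omega
    · rw [← incl_gT hi, h.mul_incl_comm ht]
    · exact hg i hi y
  · obtain hj | rfl : j < n ∨ j = n := by omega
    · rw [← incl_tT hj, h.mul_incl_comm ht]
    · exact h.mul_tT_comm y

/-- On elements a g b cyclicity with respect to g is the symmetry of the form; on elements a t^m it
is the traciality of τ₁. -/
theorem IsMarkovExtension.mul_gT_comm_of_gForm {n : ℕ} {τ₁ : YH d (n + 1) u →ₗ[ℂ] R}
    {τ₂ : YH d (n + 1 + 1) u →ₗ[ℂ] R} (h2 : IsMarkovExtension z x τ₁ τ₂) (t1 : IsTracial τ₁)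
    (hF : ∀ a b, gForm τ₂ a b = gForm τ₂ b a) (y : YH d (n + 1 + 1) u) :
    τ₂ (y * gT d _ u n) = τ₂ (gT d _ u n * y) := by
  induction y using YH_succ_induction with
  | hadd y y' hy hy' => rw [add_mul, mul_add, map_add, map_add, hy, hy']
  | ht a m =>
    rw [mul_assoc, ← gT_mul_tT_pow (by omega), ((incl_commute_tT a).pow_right m).eq,
      ← mul_assoc (gT _ _ _ _), gT_mul_tT_succ_pow (by omega), ← incl_tT (by omega : n < n + 1),
      ← map_pow, ← mul_assoc, h2.mul_gT_mul _ rfl, h2.mul_gT_mul _ rfl, t1]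
  | hg i a b hi =>
    obtain rfl : i = n := by omega
    have h := hF a b
    rw [gForm, gForm] at h
    rw [h, mul_assoc, mul_assoc, ← h2.mul_incl_comm t1]
    simp only [mul_assoc]

/-- A family of successive Markov extensions starting from a tracial functional is tracial. -/
theorem isTracial_of_isMarkovExtension [NeZero d] {tr : ∀ n, YH d n u →ₗ[ℂ] R}
    (h : ∀ n, IsMarkovExtension z x (tr n) (tr (n + 1))) (h0 : IsTracial (tr 0)) (n : ℕ) :
    IsTracial (tr n) := by
  have h1 : IsTracial (tr 1) := (h 0).isTracial_of_mul_gT h0 (by omega)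
  have h2 : IsTracial (tr 2) := by
    refine (h 1).isTracial_of_mul_gT h1 fun i hi y => ?_
    obtain rfl : i = 0 := by omega
    refine (h 1).mul_gT_comm_of_gForm h1 (fun a b => ?_) y
    refine gForm_comm (h 1) h1 a b (fun a j => ?_) (by omega)
    induction a using YH_succ_induction with
    | hadd b b' hb hb' => rw [gForm_add_left, gForm_add_right, hb, hb']
    | ht c i =>
      rw [gForm_tT_pow_tT_pow (h 1) (h 0), gForm_incl_mul_right,
        ((incl_commute_tT c).pow_right j).eq]
    | hg i c c' hi => omega
  -- The symmetry of the form uses traciality at the two preceding levels, so the induction carries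
  -- a pair; one and two strands are the base.
  suffices ∀ n, IsTracial (tr (n + 1)) ∧ IsTracial (tr (n + 2)) by
    cases n with
    | zero => exact h0
    | succ n => exact (this n).1
  intro n
  induction n with
  | zero => exact ⟨h1, h2⟩
  | succ n ih =>
    refine ⟨ih.2, (h (n + 2)).isTracial_of_mul_gT ih.2 fun i hi y => ?_⟩
    obtain rfl : i = n + 1 := by omega
    refine (h (n + 2)).mul_gT_comm_of_gForm ih.2 (fun a b => ?_) y
    refine gForm_comm (h (n + 2)) ih.2 a b
      (gForm_tT_pow_comm (h (n + 2)) (h (n + 1)) ih.2 ih.1) fun i hi => ?_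
    obtain rfl : i = n := by omega
    exact gForm_gT_comm (h (i + 2)) (h (i + 1)) ih.2 ih.1

end

end YokonumaHecke

/-! ### Existence and uniqueness of the Juyumaya trace -/

namespace YokonumaHecke

theorem eq_algebraMap_of_zero {d : ℕ} {u : ℂ} (y : YH d 0 u) : ∃ r : ℂ, y = algebraMap ℂ _ r := by
  induction y using YH_induction with
  | halg r => exact ⟨r, rfl⟩
  | hg i h => omega
  | ht j h => omega
  | hadd a b ha hb =>
    obtain ⟨r, rfl⟩ := ha
    obtain ⟨s, rfl⟩ := hb
    exact ⟨r + s, by rw [map_add]⟩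
  | hmul a b ha hb =>
    obtain ⟨r, rfl⟩ := ha
    obtain ⟨s, rfl⟩ := hb
    exact ⟨r * s, by rw [map_mul]⟩

theorem eq_of_isMarkovExtension {d : ℕ} {u : ℂ} {R : Type*} [CommRing R] [Algebra ℂ R] {z : R}
    {x : ZMod d → R} {tr tr' : ∀ n, YH d n u →ₗ[ℂ] R}
    (h : ∀ n, IsMarkovExtension z x (tr n) (tr (n + 1)))
    (h' : ∀ n, IsMarkovExtension z x (tr' n) (tr' (n + 1))) (h0 : tr 0 1 = tr' 0 1) :
    tr = tr' := by
  funext n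
  induction n with
  | zero =>
    refine LinearMap.ext fun y => ?_
    obtain ⟨r, rfl⟩ := eq_algebraMap_of_zero y
    rw [Algebra.algebraMap_eq_smul_one, map_smul, map_smul, h0]
  | succ n ih =>
    refine LinearMap.ext fun y => ?_
    induction y using YH_succ_induction with
    | hadd y y' hy hy' => rw [map_add, map_add, hy, hy']
    | ht a m => rw [(h n).mul_tT_pow, (h' n).mul_tT_pow, ih]
    | hg i a b hi => rw [(h n).mul_gT_mul i hi, (h' n).mul_gT_mul i hi, ih]

section Existence

variable {d : ℕ} [NeZero d] {u : ℂ} {R : Type*} [CommRing R] [Algebra ℂ R]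
  {z : R} {x : ZMod d → R}

/-- The relation t^d = 1 and x_0 = 1 extend the framing rule from 1 ≤ m ≤ d - 1 to all m; cyclicity
brings b next to a in the braid rule. -/
theorem IsJuyumayaTrace.isMarkovExtension {tr : ∀ n, YH d n u →ₗ[ℂ] R} (hx : x 0 = 1)
    (h : IsJuyumayaTrace d u z x tr) (n : ℕ) : IsMarkovExtension z x (tr n) (tr (n + 1)) where
  mul_tT_pow a m := by
    rw [pow_eq_pow_mod m (tT_pow n), ← ZMod.natCast_mod m d, tT_eq (Nat.lt_succ_self n)]
    obtain h0 | h0 := (m % d).eq_zero_or_pos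
    · rw [h0, pow_zero, mul_one, Nat.cast_zero, hx, one_mul, h.map_incl]
    · have := Nat.mod_lt m (NeZero.pos d)
      exact h.map_mul_t n a _ h0 (by omega)
  mul_gT_mul i hi a b := by
    subst hi
    rw [h.map_mul_comm, ← mul_assoc, ← map_mul, gT_eq (by omega), h.map_mul_g, h.map_mul_comm]

variable (d u R) in
/-- The algebra homomorphism `Y_{d,0}(u) → R`. -/
noncomputable def trZero : YH d 0 u →ₐ[ℂ] R :=
  RingQuot.liftAlgHom ℂ ⟨FreeAlgebra.lift ℂ fun
    | Gen.g i h => absurd h (by omega)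
    | Gen.t j => j.elim0, fun a b hab => by
      cases hab with
      | g_comm i j hi hj hij => omega
      | g_braid i hi hi' => omega
      | t_comm i j => exact i.elim0
      | t_g i hi j => omega
      | t_pow j => exact j.elim0
      | g_sq i hi => omega⟩

variable (d u) in
/-- The Juyumaya trace. -/
noncomputable def juyumayaTrace (z : R) (x : ZMod d → R) : ∀ n, YH d n u →ₗ[ℂ] R
  | 0 => (trZero d u R).toLinearMap
  | n + 1 => extend z x (juyumayaTrace z x n)

theorem juyumayaTrace_isMarkovExtension (n : ℕ) :
    IsMarkovExtension z x (juyumayaTrace d u z x n) (juyumayaTrace d u z x (n + 1)) where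
  mul_tT_pow := extend_mul_tT_pow z x _
  mul_gT_mul _ hi := extend_mul_gT_mul z x _ hi

theorem isJuyumayaTrace_juyumayaTrace (hx : x 0 = 1) :
    IsJuyumayaTrace d u z x (juyumayaTrace d u z x) := by
  have hM := juyumayaTrace_isMarkovExtension (u := u) (z := z) (x := x)
  have hincl : ∀ (n : ℕ) (a : YH d n u),
      juyumayaTrace d u z x (n + 1) (incl d n u a) = juyumayaTrace d u z x n a := fun n a => by
    simpa [hx] using (hM n).mul_tT_pow a 0
  have h0 : IsTracial (juyumayaTrace d u z x 0) := fun a b => by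
    change trZero d u R (a * b) = trZero d u R (b * a)
    rw [map_mul, map_mul, mul_comm]
  refine ⟨hincl, fun n => ?_, isTracial_of_isMarkovExtension hM h0, fun n a => ?_,
    fun n a m _ _ => ?_⟩
  · induction n with
    | zero => exact map_one (trZero d u R)
    | succ n ih => rw [← map_one (incl d n u), hincl, ih]
  · simpa [gT_eq] using (hM (n + 1)).mul_gT_mul n rfl a 1
  · rw [← tT_eq, (hM n).mul_tT_pow]

theorem existsUnique_isJuyumayaTrace (hx : x 0 = 1) :
    ∃! tr : ∀ n : ℕ, YH d n u →ₗ[ℂ] R, IsJuyumayaTrace d u z x tr :=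
  ⟨_, isJuyumayaTrace_juyumayaTrace hx, fun _ h =>
    eq_of_isMarkovExtension (h.isMarkovExtension hx) juyumayaTrace_isMarkovExtension
      ((h.map_one 0).trans ((isJuyumayaTrace_juyumayaTrace hx).map_one 0).symm)⟩

end Existence

end YokonumaHecke

/-! ### Framing sums and the elements c_{i,i+1} -/

namespace YokonumaHecke

theorem sum_range_pow_mul_self {A : Type*} [Ring A] {d : ℕ} {a : A} (h : a ^ d = 1) :
    (∑ s ∈ Finset.range d, a ^ s) * a = ∑ s ∈ Finset.range d, a ^ s := by
  have h1 := (Finset.sum_range_succ (fun s => a ^ s) d).symm.trans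
    (Finset.sum_range_succ' (fun s => a ^ s) d)
  rw [h, pow_zero, add_left_inj] at h1
  rw [Finset.sum_mul]
  simpa only [pow_succ] using h1.symm

theorem sum_zmod_val {A : Type*} [AddCommMonoid A] {d : ℕ} [NeZero d] (f : ℕ → A) :
    ∑ k : ZMod d, f k.val = ∑ s ∈ Finset.range d, f s := by
  obtain ⟨d, rfl⟩ := Nat.exists_eq_succ_of_ne_zero (NeZero.ne d)
  exact Fin.sum_univ_eq_sum_range f (d + 1)

section Idempotents

variable (d n : ℕ) (u : ℂ)

/-- The sum `∑_{s<d} t_j^s`. -/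
noncomputable def tSum (j : ℕ) : YH d n u := ∑ s ∈ Finset.range d, tT d n u j ^ s

/-- The product of the sums over the powers of `t_i`, `t_{i+1}` and `t_{i+2}`. -/
noncomputable def tSum₃ (i : ℕ) : YH d n u :=
  tSum d n u i * tSum d n u (i + 1) * tSum d n u (i + 2)

/-- The element `c_{i,i+1}` of `Y_{d,n}(u)`, for all `i`. -/
noncomputable def cT (i : ℕ) : YH d n u :=
  tSum₃ d n u i * (gT d n u i * gT d n u (i + 1) * gT d n u i + gT d n u (i + 1) * gT d n u i
    + gT d n u i * gT d n u (i + 1) + gT d n u i + gT d n u (i + 1) + 1)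

variable {d n u}

theorem tSum_mul_tT (j : ℕ) : tSum d n u j * tT d n u j = tSum d n u j :=
  sum_range_pow_mul_self (tT_pow j)

theorem tSum_mul_tT_pow (j k : ℕ) : tSum d n u j * tT d n u j ^ k = tSum d n u j := by
  induction k with
  | zero => simp
  | succ k ih => rw [pow_succ, ← mul_assoc, ih, tSum_mul_tT]

theorem tSum_mul_tSum (j : ℕ) : tSum d n u j * tSum d n u j = (d : ℂ) • tSum d n u j := by
  conv_lhs => arg 2; rw [tSum]
  simp only [Finset.mul_sum, tSum_mul_tT_pow, Finset.sum_const, Finset.card_range,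
    Nat.cast_smul_eq_nsmul]

theorem tT_commute_tSum (i j : ℕ) : Commute (tT d n u i) (tSum d n u j) :=
  Commute.sum_right _ _ _ fun s _ => (tT_comm i j).pow_right s

theorem tSum_commute (i j : ℕ) : Commute (tSum d n u i) (tSum d n u j) :=
  Commute.sum_left _ _ _ fun s _ => (tT_commute_tSum i j).pow_left s

theorem tSum_commute_gT {i j : ℕ} (h0 : j ≠ i) (h1 : j ≠ i + 1) :
    Commute (tSum d n u j) (gT d n u i) :=
  Commute.sum_left _ _ _ fun s _ => (tT_gT_comm h0 h1).pow_left s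

theorem tSum_mul_gT_left {i : ℕ} (h : i + 1 < n) :
    tSum d n u i * gT d n u i = gT d n u i * tSum d n u (i + 1) := by
  simp only [tSum, Finset.sum_mul, Finset.mul_sum, gT_mul_tT_succ_pow h]

theorem tSum_mul_gT_right {i : ℕ} (h : i + 1 < n) :
    tSum d n u (i + 1) * gT d n u i = gT d n u i * tSum d n u i := by
  simp only [tSum, Finset.sum_mul, Finset.mul_sum, gT_mul_tT_pow h]

theorem incl_tSum {j : ℕ} (h : j < n) : incl d n u (tSum d n u j) = tSum d (n + 1) u j := by
  simp only [tSum, map_sum, map_pow, incl_tT h]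

theorem tSum_pair_commute_gT {i : ℕ} (h : i + 1 < n) :
    Commute (tSum d n u i * tSum d n u (i + 1)) (gT d n u i) := by
  rw [commute_iff_eq, mul_assoc, tSum_mul_gT_right h, ← mul_assoc, tSum_mul_gT_left h, mul_assoc,
    (tSum_commute _ _).eq]

theorem tSum_mul_sum_pow_sub (j : ℕ) :
    ∑ s ∈ Finset.range d, tT d n u j ^ (d - s) = tSum d n u j := by
  have h := Finset.sum_range_reflect (fun s => tT d n u j ^ (s + 1)) d
  rw [← tSum_mul_tT, tSum, Finset.sum_mul]
  simp only [← pow_succ]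
  rw [← h]
  refine Finset.sum_congr rfl fun s hs => ?_
  have := Finset.mem_range.mp hs
  congr 1; omega

/-- The two framing sums absorb each of the d monomials of e_i, which cancels 1/d. The quadratic
relation thereby becomes that of the Iwahori–Hecke algebra. -/
theorem tSum_pair_mul_eT [NeZero d] (i : ℕ) :
    tSum d n u i * tSum d n u (i + 1) * eT d n u i = tSum d n u i * tSum d n u (i + 1) := by
  have hd : (d : ℂ) ≠ 0 := Nat.cast_ne_zero.mpr (NeZero.ne d)
  have hs : ∀ s ∈ Finset.range d, tSum d n u i * tSum d n u (i + 1)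
      * (tT d n u i ^ s * tT d n u (i + 1) ^ (d - s)) = tSum d n u i * tSum d n u (i + 1) := by
    intro s _
    rw [← mul_assoc, mul_assoc (tSum d n u i), ← ((tT_commute_tSum i (i + 1)).pow_left s).eq,
      ← mul_assoc, tSum_mul_tT_pow, mul_assoc, tSum_mul_tT_pow]
  rw [eT, avg, mul_smul_comm, Finset.mul_sum, Finset.sum_congr rfl hs, Finset.sum_const,
    Finset.card_range, ← Nat.cast_smul_eq_nsmul ℂ, smul_smul, one_div_mul_cancel hd, one_smul]

theorem tSum_pair_mul_gT_sq [NeZero d] {i : ℕ} (h : i + 1 < n) :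
    tSum d n u i * tSum d n u (i + 1) * (gT d n u i * gT d n u i)
      = u • (tSum d n u i * tSum d n u (i + 1))
        + (u - 1) • (tSum d n u i * tSum d n u (i + 1) * gT d n u i) := by
  rw [gT_sq h, mul_add, mul_add, mul_smul_comm, mul_smul_comm, ← mul_assoc _ (eT _ _ _ _),
    tSum_pair_mul_eT, mul_one]
  module

theorem tSum₃_commute_gT_fst {i : ℕ} (h : i + 1 < n) :
    Commute (tSum₃ d n u i) (gT d n u i) :=
  (tSum_pair_commute_gT h).mul_left (tSum_commute_gT (by omega) (by omega))

theorem tSum₃_commute_gT_snd {i : ℕ} (h : i + 2 < n) :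
    Commute (tSum₃ d n u i) (gT d n u (i + 1)) := by
  rw [tSum₃, mul_assoc]
  exact (tSum_commute_gT (by omega) (by omega)).mul_left (tSum_pair_commute_gT h)

theorem tSum₃_mul_gT_sq_fst [NeZero d] {i : ℕ} (h : i + 1 < n) :
    tSum₃ d n u i * (gT d n u i * gT d n u i)
      = u • tSum₃ d n u i + (u - 1) • (tSum₃ d n u i * gT d n u i) := by
  have e : tSum₃ d n u i = tSum d n u (i + 2) * (tSum d n u i * tSum d n u (i + 1)) :=
    ((tSum_commute _ _).mul_left (tSum_commute _ _)).eq
  rw [e, mul_assoc, tSum_pair_mul_gT_sq h, mul_add, mul_smul_comm, mul_smul_comm]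
  simp only [mul_assoc]

theorem tSum₃_mul_gT_sq_snd [NeZero d] {i : ℕ} (h : i + 2 < n) :
    tSum₃ d n u i * (gT d n u (i + 1) * gT d n u (i + 1))
      = u • tSum₃ d n u i + (u - 1) • (tSum₃ d n u i * gT d n u (i + 1)) := by
  rw [tSum₃, mul_assoc (tSum d n u i), mul_assoc, tSum_pair_mul_gT_sq h, mul_add, mul_smul_comm,
    mul_smul_comm]
  simp only [mul_assoc]

theorem tT_mul_tSum₃ {i j : ℕ} (h0 : i ≤ j) (h : j < i + 3) :
    tT d n u j * tSum₃ d n u i = tSum₃ d n u i := by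
  rw [tSum₃]
  rw [(((tT_commute_tSum j _).mul_right (tT_commute_tSum j _)).mul_right
    (tT_commute_tSum j _)).eq]
  obtain rfl | rfl | rfl : j = i ∨ j = i + 1 ∨ j = i + 2 := by omega
  · rw [mul_assoc, ← (tT_commute_tSum _ _).eq, ← mul_assoc, mul_assoc (tSum d n u j),
      ← (tT_commute_tSum _ _).eq, ← mul_assoc, tSum_mul_tT]
  · rw [mul_assoc, ← (tT_commute_tSum _ _).eq, ← mul_assoc, mul_assoc (tSum d n u i), tSum_mul_tT]
  · rw [mul_assoc, tSum_mul_tT]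

/-- Under T one has a (1 + a) = a + u + (u - 1) a = u (1 + a). -/
theorem mul_absorb {A : Type*} [Ring A] [Algebra ℂ A] {T a : A} (hc : Commute T a)
    (hs : T * (a * a) = u • T + (u - 1) • (T * a)) (X : A) :
    a * (T * ((1 + a) * X)) = u • (T * ((1 + a) * X)) := by
  have h1 : a * (T * ((1 + a) * X)) = T * a * X + T * (a * a) * X := by
    rw [← mul_assoc, ← hc.eq]; simp only [add_mul, mul_add, one_mul, mul_assoc]
  rw [h1, hs, add_mul, smul_mul_assoc, smul_mul_assoc, add_mul, one_mul, mul_add, ← mul_assoc]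
  module

theorem gT_mul_cT_fst [NeZero d] {i : ℕ} (h : i + 2 < n) :
    gT d n u i * cT d n u i = u • cT d n u i := by
  have e : cT d n u i = tSum₃ d n u i * ((1 + gT d n u i)
      * (1 + gT d n u (i + 1) + gT d n u (i + 1) * gT d n u i)) := by
    rw [cT]; congr 1; noncomm_ring
  rw [e]
  exact mul_absorb (tSum₃_commute_gT_fst (by omega)) (tSum₃_mul_gT_sq_fst (by omega)) _

theorem gT_mul_cT_snd [NeZero d] {i : ℕ} (h : i + 2 < n) :
    gT d n u (i + 1) * cT d n u i = u • cT d n u i := by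
  have e : cT d n u i = tSum₃ d n u i * ((1 + gT d n u (i + 1))
      * (1 + gT d n u i + gT d n u i * gT d n u (i + 1))) := by
    -- Rewriting the longest word by the braid relation lets 1 + g_{i+1}, instead of 1 + g_i, split
    -- off on the left.
    rw [cT, gT_braid h]; congr 1; noncomm_ring
  rw [e]
  exact mul_absorb (tSum₃_commute_gT_snd h) (tSum₃_mul_gT_sq_snd h) _

theorem exists_mul_cT_eq_smul [NeZero d] (a : YH d 3 u) :
    ∃ r : ℂ, a * cT d 3 u 0 = r • cT d 3 u 0 := by
  induction a using YH_induction with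
  | halg r => exact ⟨r, (Algebra.smul_def _ _).symm⟩
  | hg i h =>
    obtain rfl | rfl : i = 0 ∨ i = 1 := by omega
    · exact ⟨u, gT_mul_cT_fst (by omega)⟩
    · exact ⟨u, gT_mul_cT_snd (by omega)⟩
  | ht j h => exact ⟨1, by rw [cT, ← mul_assoc, tT_mul_tSum₃ (by omega) (by omega), one_smul]⟩
  | hadd a b ha hb =>
    obtain ⟨r, hr⟩ := ha
    obtain ⟨s, hs⟩ := hb
    exact ⟨r + s, by rw [add_mul, hr, hs, add_smul]⟩
  | hmul a b ha hb =>
    obtain ⟨r, hr⟩ := ha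
    obtain ⟨s, hs⟩ := hb
    exact ⟨s * r, by rw [mul_assoc, hs, mul_smul_comm, hr, smul_smul]⟩

theorem incl_cT {i : ℕ} (h : i + 2 < n) : incl d n u (cT d n u i) = cT d (n + 1) u i := by
  simp only [cT, tSum₃, map_mul, map_add, map_one, incl_gT (by omega : i + 1 < n),
    incl_gT (by omega : i + 1 + 1 < n), incl_tSum (by omega : i < n),
    incl_tSum (by omega : i + 1 < n), incl_tSum h]

theorem isUnit_gT [NeZero d] (hu : u ≠ 0) (i : ℕ) : IsUnit (gT d n u i) := by
  by_cases h : i + 1 < n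
  swap
  · rw [show gT d n u i = 1 from dif_neg h]; exact isUnit_one
  have he := (map_eT_commute_gT (d := d) (u := u) h).eq
  have hi : eT d n u i * eT d n u i = eT d n u i :=
    avg_mul_avg_self (tT_comm _ _) (tT_pow _) (tT_pow _)
  have hsq := gT_sq (d := d) (u := u) h
  have hesq : eT d n u i * (gT d n u i * gT d n u i)
      = u • eT d n u i + (u - 1) • (eT d n u i * gT d n u i) := by
    rw [hsq, mul_add, mul_add, mul_one, mul_smul_comm, mul_smul_comm, ← mul_assoc, hi]
    module
  -- Off the idempotent e_i the generator is an involution; on it g² = u + (u - 1) g, with inverse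
  -- u⁻¹ g + u⁻¹ - 1. This is the combination of both.
  have hr : gT d n u i * (gT d n u i + (u⁻¹ - 1) • eT d n u i
      + (u⁻¹ - 1) • (eT d n u i * gT d n u i)) = 1 := by
    rw [mul_add, mul_add, mul_smul_comm, mul_smul_comm, ← mul_assoc (gT _ _ _ _) (eT _ _ _ _), ← he,
      mul_assoc, hesq, hsq]
    match_scalars <;> field_simp <;> ring
  have hl : (gT d n u i + (u⁻¹ - 1) • eT d n u i
      + (u⁻¹ - 1) • (eT d n u i * gT d n u i)) * gT d n u i = 1 := by
    rw [← hr, add_mul, add_mul, mul_add, mul_add, smul_mul_assoc, smul_mul_assoc, mul_smul_comm,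
      mul_smul_comm, ← mul_assoc (gT _ _ _ _) (eT _ _ _ _), ← he]
  exact ⟨⟨_, _, hr, hl⟩, rfl⟩

/-- The word g_i g_{i+1} g_{i+2} intertwines the strands i, i+1, i+2 with their shift by one, for
framing sums and braid generators alike. -/
theorem cT_succ_mul {i : ℕ} (h : i + 3 < n) :
    cT d n u (i + 1) * (gT d n u i * gT d n u (i + 1) * gT d n u (i + 2))
      = gT d n u i * gT d n u (i + 1) * gT d n u (i + 2) * cT d n u i := by
  set X := gT d n u i * gT d n u (i + 1) * gT d n u (i + 2) with hX
  have g1 : SemiconjBy X (gT d n u i) (gT d n u (i + 1)) := by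
    rw [SemiconjBy, hX, mul_assoc, ← (gT_comm (by omega : i + 1 < i + 2)).eq, ← mul_assoc,
      gT_braid (by omega)]
    simp only [mul_assoc]
  have g2 : SemiconjBy X (gT d n u (i + 1)) (gT d n u (i + 2)) := by
    have hb := gT_braid (d := d) (u := u) (by omega : i + 1 + 2 < n)
    rw [SemiconjBy, hX, mul_assoc, mul_assoc, ← mul_assoc (gT d n u (i + 1)), hb]
    simp only [← mul_assoc]
    rw [(gT_comm (by omega : i + 1 < i + 1 + 1)).eq]
  have s0 : ∀ {i : ℕ}, i + 1 < n →
      SemiconjBy (gT d n u i) (tSum d n u i) (tSum d n u (i + 1)) :=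
    fun h => (tSum_mul_gT_right h).symm
  have hc : ∀ {i j : ℕ}, j ≠ i → j ≠ i + 1 →
      SemiconjBy (gT d n u i) (tSum d n u j) (tSum d n u j) :=
    fun h0 h1 => (tSum_commute_gT h0 h1).symm
  have s1 : SemiconjBy X (tSum d n u i) (tSum d n u (i + 1)) :=
    ((s0 (by omega)).mul_left (hc (by omega) (by omega))).mul_left (hc (by omega) (by omega))
  have s2 : SemiconjBy X (tSum d n u (i + 1)) (tSum d n u (i + 2)) :=
    ((hc (by omega) (by omega)).mul_left (s0 (by omega))).mul_left (hc (by omega) (by omega))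
  have s3 : SemiconjBy X (tSum d n u (i + 2)) (tSum d n u (i + 3)) :=
    ((hc (by omega) (by omega)).mul_left (hc (by omega) (by omega))).mul_left (s0 (by omega))
  refine (SemiconjBy.eq ?_).symm
  exact ((s1.mul_right s2).mul_right s3).mul_right
    (((((((g1.mul_right g2).mul_right g1).add_right (g2.mul_right g1)).add_right
      (g1.mul_right g2)).add_right g1).add_right g2).add_right (SemiconjBy.one_right X))

end Idempotents

end YokonumaHecke

/-! ### Vanishing of a trace on the defining ideal of CTL -/

namespace YokonumaHecke

theorem t_eq_tT {d n : ℕ} {u : ℂ} {j : ℕ} (h : j < n) : t d u j h = tT d n u j := (tT_eq h).symm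

theorem g_eq_gT {d n : ℕ} {u : ℂ} {i : ℕ} (h : i + 1 < n) : g d u i h = gT d n u i := (gT_eq h).symm

section Quotient

variable {d : ℕ} [NeZero d] {n : ℕ} {u : ℂ}

theorem c_eq_cT {i : ℕ} (h : i + 2 < n) : c d u i h = cT d n u i := by
  have hT : ∀ j, tSum d n u j = ∑ k : ZMod d, tT d n u j ^ k.val := fun j =>
    (sum_zmod_val fun s => tT d n u j ^ s).symm
  simp only [c, cT, tSum₃, hT, t_eq_tT, gSteinberg, g_eq_gT, ← Finset.sum_mul, ← Finset.mul_sum]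

/-- Summing over k first produces S_0, which absorbs the factor t_0^s, so the sums over the two
strands separate. -/
theorem sum_eK (h : 0 + 1 < n) :
    ∑ k : ZMod d, eK d u 0 h k.val = (1 / (d : ℂ)) • (tSum d n u 0 * tSum d n u 1) := by
  rw [sum_zmod_val (fun k => eK d u 0 h k)]
  simp only [eK, t_eq_tT, ← Finset.smul_sum]
  rw [Finset.sum_comm]
  congr 1
  rw [← tSum_mul_sum_pow_sub 1, Finset.mul_sum]
  refine Finset.sum_congr rfl fun s _ => ?_
  simp only [← Finset.sum_mul, pow_add]
  congr 1
  exact tSum_mul_tT_pow 0 s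

theorem sum_eK_mul_e (h : 0 + 1 < n) (h' : 1 + 1 < n) :
    ∑ k : ZMod d, eK d u 0 h k.val * e d u 1 h'
      = (1 / (d : ℂ)) • ((1 / (d : ℂ)) • tSum₃ d n u 0) := by
  rw [← Finset.sum_mul, sum_eK, smul_mul_assoc, e, eK, mul_smul_comm]
  congr 2
  simp only [t_eq_tT, zero_add, Finset.mul_sum]
  rw [tSum₃, ← tSum_mul_sum_pow_sub (0 + 2), Finset.mul_sum]
  refine Finset.sum_congr rfl fun s _ => ?_
  rw [← mul_assoc, mul_assoc (tSum _ _ _ 0), tSum_mul_tT_pow]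

variable {R : Type*} [CommRing R] [Algebra ℂ R]

theorem passesToCTL_iff (τ : YH d n u →ₗ[ℂ] R) :
    PassesToCTL d n u τ ↔ ∀ y ∈ ctlIdeal d n u, τ y = 0 := by
  have hker : ∀ y, toCTL d n u y = 0 ↔ y ∈ ctlIdeal d n u := fun y => by
    rw [TwoSidedIdeal.mem_iff, ← RingCon.eq]
    rfl
  constructor
  · rintro ⟨τ', h⟩ y hy
    rw [← h, (hker y).mpr hy, map_zero]
  · intro h
    -- Over the field ℂ the projection has a linear section; composing τ with it gives the induced
    -- functional.
    obtain ⟨s, hs⟩ := (toCTL d n u).toLinearMap.exists_rightInverse_of_surjective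
      (LinearMap.range_eq_top.mpr fun y => RingCon.mkₐ_surjective (α := ℂ) (ctlIdeal d n u).ringCon y)
    refine ⟨τ ∘ₗ s, fun y => ?_⟩
    rw [LinearMap.comp_apply, ← sub_eq_zero, ← map_sub]
    refine h _ ((hker _).mp ?_)
    have := LinearMap.congr_fun hs (toCTL d n u y)
    simp only [LinearMap.comp_apply, LinearMap.id_apply, AlgHom.toLinearMap_apply] at this
    rw [map_sub, this, sub_self]

/-- By traciality the elements y with τ(ay) = 0 for all a form a two-sided ideal, so it suffices
that the generators lie in it. -/
theorem passesToCTL_iff_of_isTracial {τ : YH d n u →ₗ[ℂ] R} (ht : IsTracial τ) :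
    PassesToCTL d n u τ ↔ ∀ i, i + 2 < n → ∀ a, τ (a * cT d n u i) = 0 := by
  rw [passesToCTL_iff]
  constructor
  · intro h i hi a
    refine h _ (TwoSidedIdeal.mul_mem_left _ _ _ (TwoSidedIdeal.subset_span ⟨i, hi, ?_⟩))
    rw [c_eq_cT]
  · intro h y hy
    let I : TwoSidedIdeal (YH d n u) := TwoSidedIdeal.mk' {y | ∀ a, τ (a * y) = 0}
      (fun a => by simp) (fun h1 h2 a => by rw [mul_add, map_add, h1 a, h2 a, add_zero])
      (fun {y} h1 a => by
        rw [show a * -y = -(a * y) from mul_neg a y, map_neg, h1 a, neg_zero])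
      (fun h1 a => by rw [← mul_assoc]; exact h1 _)
      (fun {y b} h1 a => by rw [← mul_assoc, ht, ← mul_assoc]; exact h1 _)
    have hI : ∀ {y}, y ∈ I ↔ ∀ a, τ (a * y) = 0 := TwoSidedIdeal.mem_mk' _ _ _ _ _ _ _
    have := TwoSidedIdeal.mem_span_iff.mp hy I (by
      rintro _ ⟨i, hi, rfl⟩
      exact hI.mpr fun a => by rw [c_eq_cT]; exact h i hi a)
    simpa using hI.mp this 1

/-- For u ≠ 0 the braid generators are units, so c_{i+1,i+2} is conjugate to c_{i,i+1} and cyclicity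
transfers the vanishing. -/
theorem map_mul_cT_eq_zero (hu : u ≠ 0) {τ : YH d n u →ₗ[ℂ] R} (ht : IsTracial τ)
    (h : ∀ a, τ (a * cT d n u 0) = 0) (i : ℕ) (hi : i + 2 < n) (a : YH d n u) :
    τ (a * cT d n u i) = 0 := by
  induction i generalizing a with
  | zero => exact h a
  | succ i ih =>
    obtain ⟨X, hX⟩ : IsUnit (gT d n u i * gT d n u (i + 1) * gT d n u (i + 2)) :=
      ((isUnit_gT hu _).mul (isUnit_gT hu _)).mul (isUnit_gT hu _)
    have h1 := cT_succ_mul (d := d) (u := u) (by omega : i + 3 < n)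
    rw [← hX] at h1
    rw [← Units.mul_inv_cancel_right (cT d n u (i + 1)) X, h1, ← mul_assoc, ht, ← mul_assoc,
      ← mul_assoc]
    exact ih (by omega) _

end Quotient

theorem IsMarkovExtension.map_incl {d : ℕ} {u : ℂ} {R : Type*} [CommRing R] [Algebra ℂ R]
    {z : R} {x : ZMod d → R} {n : ℕ} {τ : YH d n u →ₗ[ℂ] R} {τ' : YH d (n + 1) u →ₗ[ℂ] R}
    (h : IsMarkovExtension z x τ τ') (hx : x 0 = 1) (a : YH d n u) : τ' (incl d n u a) = τ a := by
  simpa [hx] using h.mul_tT_pow a 0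

/-! ### Values of the trace on c and its summands -/

section Values

variable {d : ℕ} [NeZero d] {u : ℂ} {R : Type*} [CommRing R] [Algebra ℂ R] {z : R} {x : ZMod d → R}

theorem IsMarkovExtension.mul_tSum {n : ℕ} {τ : YH d n u →ₗ[ℂ] R} {τ' : YH d (n + 1) u →ₗ[ℂ] R}
    (h : IsMarkovExtension z x τ τ') (a : YH d n u) :
    τ' (incl d n u a * tSum d _ u n) = (∑ k, x k) * τ a := by
  have hS : ∑ k, x k = ∑ s ∈ Finset.range d, x s := by
    rw [← sum_zmod_val (fun s => x s)]
    simp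
  simp only [tSum, Finset.mul_sum, map_sum, h.mul_tT_pow, hS, Finset.sum_mul]

variable {tr : ∀ n, YH d n u →ₗ[ℂ] R}
  (h : ∀ n, IsMarkovExtension z x (tr n) (tr (n + 1)))

include h in
-- On three strands every multiple a c is a scalar times c. Each further strand is removed by a
-- Markov rule, because c already lies one level below.
theorem exists_map_mul_cT {n : ℕ} (hn : 3 ≤ n) (a : YH d n u) :
    ∃ r : R, tr n (a * cT d n u 0) = r * tr 3 (cT d 3 u 0) := by
  induction n, hn using Nat.le_induction with
  | base =>
    obtain ⟨r, hr⟩ := exists_mul_cT_eq_smul a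
    exact ⟨algebraMap ℂ R r, by rw [hr, map_smul, Algebra.smul_def]⟩
  | succ n hn ih =>
    rw [← incl_cT (by omega : 0 + 2 < n)]
    induction a using YH_succ_induction with
    | hadd y y' hy hy' =>
      obtain ⟨r, hr⟩ := hy
      obtain ⟨s, hs⟩ := hy'
      exact ⟨r + s, by rw [add_mul, map_add, hr, hs, add_mul]⟩
    | ht a m =>
      obtain ⟨r, hr⟩ := ih a
      exact ⟨x m * r, by rw [mul_assoc, ← ((incl_commute_tT _).pow_right m).eq, ← mul_assoc,
        ← map_mul, (h n).mul_tT_pow, hr, mul_assoc]⟩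
    | hg i a b hi =>
      obtain ⟨r, hr⟩ := ih (a * b)
      exact ⟨z * r, by rw [mul_assoc, ← map_mul, (h n).mul_gT_mul i hi, ← mul_assoc, hr, mul_assoc]⟩

variable (hx : x 0 = 1) (h1 : tr 0 1 = 1)

omit [NeZero d] in
include hx h in
theorem map_cT_eq {n : ℕ} (hn : 3 ≤ n) : tr n (cT d n u 0) = tr 3 (cT d 3 u 0) := by
  induction n, hn using Nat.le_induction with
  | base => rfl
  | succ n hn ih => rw [← incl_cT (by omega), (h n).map_incl hx, ih]

include h h1 in
theorem map_tSum_zero : tr 1 (tSum d 1 u 0) = ∑ k, x k := by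
  have := (h 0).mul_tSum 1
  rwa [map_one, one_mul, h1, mul_one] at this

include h h1 in
theorem map_tSum_pair : tr 2 (tSum d 2 u 0 * tSum d 2 u 1) = (∑ k, x k) ^ 2 := by
  rw [← incl_tSum (by omega : 0 < 1), (h 1).mul_tSum, map_tSum_zero h h1, sq]

include hx h h1 in
theorem map_tSum_pair_of_le {n : ℕ} (hn : 2 ≤ n) :
    tr n (tSum d n u 0 * tSum d n u 1) = (∑ k, x k) ^ 2 := by
  induction n, hn using Nat.le_induction with
  | base => exact map_tSum_pair h h1
  | succ n hn ih =>
    rw [← incl_tSum (by omega), ← incl_tSum (by omega), ← map_mul, (h n).map_incl hx, ih]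

include h h1 in
theorem map_tSum₃ : tr 3 (tSum₃ d 3 u 0) = (∑ k, x k) ^ 3 := by
  rw [tSum₃, ← incl_tSum (by omega : 0 < 2), ← incl_tSum (by omega : 0 + 1 < 2), ← map_mul,
    (h 2).mul_tSum, map_tSum_pair h h1]
  ring

include hx h h1 in
theorem map_tSum₃_of_le {n : ℕ} (hn : 3 ≤ n) : tr n (tSum₃ d n u 0) = (∑ k, x k) ^ 3 := by
  induction n, hn using Nat.le_induction with
  | base => exact map_tSum₃ h h1
  | succ n hn ih =>
    rw [tSum₃, ← incl_tSum (by omega), ← incl_tSum (by omega), ← incl_tSum (by omega),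
      ← map_mul, ← map_mul, (h n).map_incl hx]
    exact ih

include h h1 in
-- S_0 S_1 g_0 = S_0 g_0 S_0, and the Markov rule leaves z tr(S_0²) = d z tr(S_0).
theorem map_tSum_pair_mul_gT :
    tr 2 (tSum d 2 u 0 * tSum d 2 u 1 * gT d 2 u 0) = (d : ℂ) • (z * ∑ k, x k) := by
  rw [mul_assoc, tSum_mul_gT_right (by omega), ← mul_assoc, ← incl_tSum (by omega : 0 < 1),
    (h 1).mul_gT_mul 0 rfl, tSum_mul_tSum, map_smul, map_tSum_zero h h1, mul_smul_comm]

omit [NeZero d] in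
theorem tSum_pair_mul_tSum (n : ℕ) : tSum d n u 0 * tSum d n u 1 * tSum d n u 1
    = (d : ℂ) • (tSum d n u 0 * tSum d n u 1) := by
  rw [mul_assoc, tSum_mul_tSum, mul_smul_comm]

omit [NeZero d] in
theorem tSum₃_mul_gT_one : tSum₃ d 3 u 0 * gT d 3 u 1
    = incl d 2 u (tSum d 2 u 0 * tSum d 2 u 1) * gT d 3 u 1 * incl d 2 u (tSum d 2 u 1) := by
  rw [tSum₃, mul_assoc, tSum_mul_gT_right (by omega), map_mul, incl_tSum (by omega),
    incl_tSum (by omega), mul_assoc, mul_assoc, mul_assoc]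

include h h1 in
theorem map_tSum₃_mul_gT_zero :
    tr 3 (tSum₃ d 3 u 0 * gT d 3 u 0) = (d : ℂ) • (z * (∑ k, x k) ^ 2) := by
  have e : tSum₃ d 3 u 0 * gT d 3 u 0
      = incl d 2 u (tSum d 2 u 0 * tSum d 2 u 1 * gT d 2 u 0) * tSum d 3 u 2 := by
    rw [tSum₃, mul_assoc, (tSum_commute_gT (by omega) (by omega)).eq, map_mul, map_mul,
      incl_tSum (by omega), incl_tSum (by omega), incl_gT (by omega), mul_assoc, mul_assoc,
      mul_assoc]
  rw [e, (h 2).mul_tSum, map_tSum_pair_mul_gT h h1, mul_smul_comm]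
  congr 1
  ring

include h h1 in
theorem map_tSum₃_mul_gT_one :
    tr 3 (tSum₃ d 3 u 0 * gT d 3 u 1) = (d : ℂ) • (z * (∑ k, x k) ^ 2) := by
  rw [tSum₃_mul_gT_one, (h 2).mul_gT_mul 1 rfl, tSum_pair_mul_tSum, map_smul, map_tSum_pair h h1,
    mul_smul_comm]

include h h1 in
theorem map_tSum₃_mul_gT_one_mul_gT_zero :
    tr 3 (tSum₃ d 3 u 0 * (gT d 3 u 1 * gT d 3 u 0))
      = (d : ℂ) • (d : ℂ) • (z ^ 2 * ∑ k, x k) := by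
  rw [← mul_assoc, tSum₃_mul_gT_one, mul_assoc, ← incl_gT (by omega : 0 + 1 < 2), ← map_mul,
    (h 2).mul_gT_mul 1 rfl, ← mul_assoc, tSum_pair_mul_tSum, smul_mul_assoc, map_smul,
    map_tSum_pair_mul_gT h h1, mul_smul_comm, mul_smul_comm, sq, mul_assoc]

variable (ht : IsTracial (tr 2))

include h h1 ht in
theorem map_tSum₃_mul_gT_zero_mul_gT_one :
    tr 3 (tSum₃ d 3 u 0 * (gT d 3 u 0 * gT d 3 u 1))
      = (d : ℂ) • (d : ℂ) • (z ^ 2 * ∑ k, x k) := by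
  rw [← mul_assoc, (tSum₃_commute_gT_fst (by omega)).eq, mul_assoc, tSum₃_mul_gT_one, ← mul_assoc,
    ← mul_assoc, ← incl_gT (by omega : 0 + 1 < 2), ← map_mul,
    (h 2).mul_gT_mul 1 rfl, mul_assoc, tSum_pair_mul_tSum, mul_smul_comm, map_smul, ht,
    map_tSum_pair_mul_gT h h1, mul_smul_comm, mul_smul_comm, sq, mul_assoc]

include h h1 ht in
-- After the Markov rule has removed g_1, cyclicity of the trace on two strands joins the outer
-- letters into g_0²; the quadratic relation on S_0 S_1 gives the coefficients u and u - 1.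
theorem map_tSum₃_mul_gT_braid :
    tr 3 (tSum₃ d 3 u 0 * (gT d 3 u 0 * gT d 3 u 1 * gT d 3 u 0))
      = (d : ℂ) • (u • (z * (∑ k, x k) ^ 2)
        + (u - 1) • (d : ℂ) • (z ^ 2 * ∑ k, x k)) := by
  rw [← mul_assoc, ← mul_assoc, (tSum₃_commute_gT_fst (by omega)).eq, mul_assoc (gT _ _ _ _),
    tSum₃_mul_gT_one, ← mul_assoc, ← mul_assoc, ← incl_gT (by omega : 0 + 1 < 2), ← map_mul,
    mul_assoc, ← map_mul, (h 2).mul_gT_mul 1 rfl, mul_assoc, ← mul_assoc _ (tSum _ _ _ 1),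
    tSum_pair_mul_tSum, ht, smul_mul_assoc, smul_mul_assoc, mul_assoc,
    tSum_pair_mul_gT_sq (by omega), map_smul, map_add, map_smul, map_smul,
    map_tSum_pair_mul_gT h h1, map_tSum_pair h h1, mul_smul_comm, mul_add, mul_smul_comm,
    mul_smul_comm, mul_smul_comm, sq z, mul_assoc]

include h h1 ht in
theorem map_cT : tr 3 (cT d 3 u 0)
    = (d : ℂ) • (d : ℂ) • ((u + 1) • (z ^ 2 * ∑ k, x k)
      + (u + 2) • (z * ((1 / (d : ℂ)) • (∑ k, x k) ^ 2))
      + (1 / (d : ℂ)) • ((1 / (d : ℂ)) • (∑ k, x k) ^ 3)) := by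
  have hd : (d : ℂ) ≠ 0 := Nat.cast_ne_zero.mpr (NeZero.ne d)
  simp only [cT, mul_add, mul_one, map_add, map_tSum₃_mul_gT_braid h h1 ht,
    map_tSum₃_mul_gT_one_mul_gT_zero h h1, map_tSum₃_mul_gT_zero_mul_gT_one h h1 ht,
    map_tSum₃_mul_gT_zero h h1, map_tSum₃_mul_gT_one h h1, map_tSum₃ h h1, mul_smul_comm]
  -- With X = ∑ x_k the longest word contributes u d z X² + (u-1) d² z² X, the words of length two 2
  -- d² z² X, those of length one 2 d z X², and the empty word X³.
  match_scalars <;> field_simp <;> ring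

end Values

end YokonumaHecke

theorem mainTheorem3 (d : ℕ) [NeZero d] (u : ℂ) (hu : u ≠ 0)
    {R : Type*} [CommRing R] [Algebra ℂ R] (z : R) (x : ZMod d → R) (hx : x 0 = 1) :
    (∃! tr : ∀ n : ℕ, YokonumaHecke.YH d n u →ₗ[ℂ] R,
      YokonumaHecke.IsJuyumayaTrace d u z x tr) ∧
    ∀ tr : ∀ n : ℕ, YokonumaHecke.YH d n u →ₗ[ℂ] R,
      YokonumaHecke.IsJuyumayaTrace d u z x tr →
      ∀ (n : ℕ) (hn : 3 ≤ n),
        YokonumaHecke.PassesToCTL d n u (tr n) ↔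
          (u + 1) • (z ^ 2 * ∑ k : ZMod d, x k)
            + (u + 2) • (z * ∑ k : ZMod d,
                tr n (YokonumaHecke.eK d u 0 (by lia) k.val))
            + ∑ k : ZMod d,
                tr n (YokonumaHecke.eK d u 0 (by lia) k.val *
                  YokonumaHecke.e d u 1 (by lia)) = 0 := by
  refine ⟨YokonumaHecke.existsUnique_isJuyumayaTrace hx, fun tr htr n hn => ?_⟩
  have hM := htr.isMarkovExtension hx
  have h1 := htr.map_one 0
  have hd : (d : ℂ) ≠ 0 := Nat.cast_ne_zero.mpr (NeZero.ne d)
  rw [YokonumaHecke.passesToCTL_iff_of_isTracial (htr.map_mul_comm n), ← map_sum, ← map_sum,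
    YokonumaHecke.sum_eK, YokonumaHecke.sum_eK_mul_e, map_smul, map_smul, map_smul,
    YokonumaHecke.map_tSum_pair_of_le hM hx h1 (by lia), YokonumaHecke.map_tSum₃_of_le hM hx h1 hn]
  have hc := YokonumaHecke.map_cT hM h1 (htr.map_mul_comm 2)
  constructor
  · intro h
    have h0 := h 0 (by lia) 1
    rw [one_mul, YokonumaHecke.map_cT_eq hM hx hn, hc] at h0
    -- The trace of c is d² times the required expression, and d is invertible in ℂ.
    rwa [smul_eq_zero_iff_right hd, smul_eq_zero_iff_right hd] at h0
  · intro h i hi a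
    refine YokonumaHecke.map_mul_cT_eq_zero hu (htr.map_mul_comm n) (fun a => ?_) i hi a
    obtain ⟨r, hr⟩ := YokonumaHecke.exists_map_mul_cT hM hn a
    rw [hr, hc, h, smul_zero, smul_zero, mul_zero]
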